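/- Let $S^2\subset\mathbb R^3$ be the unit sphere, oriented as the boundary of the closed unit ball $B^3$. Let $\iota:S^2\to\mathbb R^3$ be a smooth immersion with transverse self-intersections, i.e. $d\iota_p(T_pS^2)+d\iota_{p'}(T_{p'}S^2)=\mathbb R^3$ whenever $p\neq p'$ and $\iota(p)=\iota(p')$. Put $\Sigma=\iota(S^2)$ and let $\Omega_\infty$ be the unbounded component of $\mathbb R^3\setminus\Sigma$. Let $\nu$ be the oriented unit normal: on the sheet at $p$ it is the direction of $d\iota_p(v_0)\times d\iota_p(v_1)$ for a positively oriented basis $(v_0,v_1)$ of $T_pS^2$. For $y\in\mathbb R^3\setminus\Sigma$ and $p_\infty\in\Omega_\infty$, a *cable* from $y$ to $p_\infty$ is a smooth simple path $\pi:[0,1]\to\mathbb R^3$ with $\pi(0)=y$, $\pi(1)=p_\infty$ that meets $\Sigma$ finitely many times, transversely, and only at points with exactly one preimage under $\iota$. Its index is $$\sum_{q\in\pi\cap\Sigma}\operatorname{sign}\langle\dot\pi(q),\nu(q)\rangle\in\mathbb Z .$$ Let $f:B^3\to\mathbb R^3$ be a $C^1$ map with $f|_{S^2}=\iota$. For $y\notin\Sigma$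 let $d(f,B^3,y)\in\mathbb Z$ be its Brouwer degree, i.e. the common value of $\sum_{x\in f^{-1}(z)}\operatorname{sign}\det Df(x)$ at all regular values $z$ near $y$. **Proposition.** Let $\Omega$ be a connected component of $\mathbb R^3\setminus\Sigma$. There is an integer $C(\Omega)$, the cable index of $\Omega$, such that 1. $d(f,B^3,y)=C(\Omega)$ for every $y\in\Omega$; 2. for all $y\in\Omega$ and $p_\infty\in\Omega_\infty$ with $y\neq p_\infty$ there is a cable from $y$ to $p_\infty$; 3. for all $y\in\Omega$ and $p_\infty\in\Omega_\infty$, every cable from $y$ to $p_\infty$ has index $C(\Omega)$. In particular the cable index equals the Brouwer degree, is constant on $\Omega$, and is independent of the choice of $y$, $p_\infty$ and the cable. -/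

import Mathlib

open Set Filter Topology Metric
open scoped Manifold ContDiff Matrix InnerProductSpace

/-! ### Brouwer degree of `C¹` maps -/

section Degree

variable {E : Type*} [NormedAddCommGroup E] [NormedSpace ℝ E]

/-- `z` is a regular value of `f : closure U → E`, away from the image of the boundary of the open
set `U`. -/
def IsRegularValueOn (f : E → E) (U : Set E) (z : E) : Prop :=
  z ∉ f '' frontier U ∧ ∀ x ∈ U, f x = z → (fderiv ℝ f x).det ≠ 0

/-- The algebraic number of preimages of `z` in `U`: the sum of `sign (det Df(x))` over the
`x ∈ U` with `f x = z`. For `U` open and bounded in a finite-dimensional space, `f` continuous on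
the closure of `U` and `C¹` on `U`, and `z` a regular value, there are finitely many such `x`. -/
noncomputable def signedPreimageCount (f : E → E) (U : Set E) (z : E) : ℤ :=
  ∑ᶠ x ∈ {x | x ∈ U ∧ f x = z}, (SignType.sign (fderiv ℝ f x).det : ℤ)

/-- `HasBrouwerDegree f U y n`: the Brouwer degree `d(f, U, y)` of the map `f` (continuous on the
closure of the bounded open set `U`, and `C¹` on `U`) at the point `y ∉ f(∂U)` is the integer `n`.
It is the common value of the algebraic number of preimages at all regular values near `y`
(including `y` itself if it is one), and there are such values arbitrarily close to `y`. -/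
def HasBrouwerDegree (f : E → E) (U : Set E) (y : E) (n : ℤ) : Prop :=
  y ∉ f '' frontier U ∧
  (∃ᶠ z in 𝓝 y, IsRegularValueOn f U z) ∧
  ∀ᶠ z in 𝓝 y, IsRegularValueOn f U z → signedPreimageCount f U z = n

theorem HasBrouwerDegree.unique {f : E → E} {U : Set E} {y : E} {m n : ℤ}
    (hm : HasBrouwerDegree f U y m) (hn : HasBrouwerDegree f U y n) : m = n := by
  obtain ⟨z, hz, h₁, h₂⟩ := (hm.2.1.and_eventually (hm.2.2.and hn.2.2)).exists
  exact (h₁ hz).symm.trans (h₂ hz)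

/-- At a regular value the degree is the algebraic number of preimages. -/
theorem HasBrouwerDegree.eq_signedPreimageCount {f : E → E} {U : Set E} {y : E} {n : ℤ}
    (h : HasBrouwerDegree f U y n) (hy : IsRegularValueOn f U y) :
    n = signedPreimageCount f U y :=
  (h.2.2.self_of_nhds hy).symm

end Degree

/-! ### Immersed spheres in Euclidean three-space -/

/-- Euclidean three-space. -/
abbrev E3 : Type := EuclideanSpace ℝ (Fin 3)

/-- The unit sphere, with Mathlib's smooth structure. -/
abbrev S2 : Type := sphere (0 : E3) 1

/-- The differential `dι_p : T_p S² → ℝ³`. -/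
noncomputable def sphereDiff (ι : S2 → E3) (p : S2) : TangentSpace (𝓡 2) p →L[ℝ] E3 :=
  mvfderiv (𝓡 2) ι p

/-- A smooth immersion of the sphere all of whose self-intersections are transverse: wherever two
sheets meet, their tangent planes together span `ℝ³`. -/
structure IsTransverseImmersion (ι : S2 → E3) : Prop where
  smooth : ContMDiff (𝓡 2) 𝓘(ℝ, E3) ∞ ι
  immersion : ∀ p, Function.Injective (sphereDiff ι p)
  transverse : ∀ p p', p ≠ p' → ι p = ι p' →
    (sphereDiff ι p).range ⊔ (sphereDiff ι p').range = ⊤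

/-- The cross product on `ℝ³`. -/
def cross3 (a b : E3) : E3 := WithLp.toLp 2 (a.ofLp ⨯₃ b.ofLp)

/-- The `i`-th vector of a basis of `T_p S²` (which one does not matter below). -/
noncomputable def tangentBasis (p : S2) (i : Fin 2) : TangentSpace (𝓡 2) p :=
  EuclideanSpace.basisFun (Fin 2) ℝ i

/-- A normal vector to the sheet of `ι` at `p`, in the direction determined by the standard
orientation of `S²` as the boundary of the ball (outward normal first): for a basis `(v₀, v₁)` of
`T_p S²` it is `det (p, v₀, v₁) • (dι_p v₀ × dι_p v₁)`. Replacing the basis rescales this by the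
square of the determinant of the change of basis, so the direction is well defined, and for a
positively oriented basis it is the direction of `dι_p v₀ × dι_p v₁`. -/
noncomputable def orientedNormal (ι : S2 → E3) (p : S2) : E3 :=
  inner ℝ (p : E3)
      (cross3 (sphereDiff (fun q : S2 => (q : E3)) p (tangentBasis p 0))
        (sphereDiff (fun q : S2 => (q : E3)) p (tangentBasis p 1))) •
    cross3 (sphereDiff ι p (tangentBasis p 0)) (sphereDiff ι p (tangentBasis p 1))

/-- The oriented unit normal `ν` of the immersed sphere `ι` on the sheet at `p`. -/
noncomputable def unitNormal (ι : S2 → E3) (p : S2) : E3 :=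
  ‖orientedNormal ι p‖⁻¹ • orientedNormal ι p

/-- `Ω` is a connected component of the complement of the immersed sphere. -/
def IsRegion (ι : S2 → E3) (Ω : Set E3) : Prop :=
  ∃ x ∈ (range ι)ᶜ, Ω = connectedComponentIn (range ι)ᶜ x

/-- `Ω` is the exterior region, the unbounded component of the complement. -/
def IsExterior (ι : S2 → E3) (Ω : Set E3) : Prop :=
  IsRegion ι Ω ∧ ¬ Bornology.IsBounded Ω

/-- The velocity of a path parametrized by `[0, 1]`. -/
noncomputable def velocity (π : ℝ → E3) (t : ℝ) : E3 := derivWithin π (Icc 0 1) t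

/-- `π : [0, 1] → ℝ³` is a cable from `y` to `z` for the immersed sphere `ι`: a smooth simple path
that meets the surface finitely many times, only at regular points (points with exactly one
preimage under `ι`), and transversely. -/
structure IsCable (ι : S2 → E3) (y z : E3) (π : ℝ → E3) : Prop where
  smooth : ContDiffOn ℝ ∞ π (Icc 0 1)
  simple : InjOn π (Icc 0 1)
  source : π 0 = y
  target : π 1 = z
  finite : {t ∈ Icc (0 : ℝ) 1 | π t ∈ range ι}.Finite
  regular : ∀ t ∈ Icc (0 : ℝ) 1, ∀ p p', π t = ι p → π t = ι p' → p = p'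
  transverse : ∀ t ∈ Icc (0 : ℝ) 1, ∀ p, π t = ι p →
    Submodule.span ℝ {velocity π t} ⊔ (sphereDiff ι p).range = ⊤

/-- The signed number of crossings of the path `π` with the immersed sphere `ι`, the sum of
`sign ⟨π'(q), ν(q)⟩` over the crossing points `q`. For a cable, `q = π t = ι p` gives a bijection
between the crossing points and the pairs `(t, p)` with `π t = ι p`, and these are finitely many. -/
noncomputable def cableIndex (ι : S2 → E3) (π : ℝ → E3) : ℤ :=
  ∑ᶠ c ∈ {c : ℝ × S2 | c.1 ∈ Icc (0 : ℝ) 1 ∧ π c.1 = ι c.2},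
    (SignType.sign (inner ℝ (velocity π c.1) (unitNormal ι c.2)) : ℤ)

/-! The Brouwer degree of a filling is locally constant off the surface, vanishes on the exterior
region, and drops by `sign ⟨π', ν⟩` whenever a path crosses one sheet transversely. Adding the drops
along a cable that ends in the exterior shows that its index is the degree at its starting point
(`cableIndex_eq_sub`). Constancy on `Ω` and independence of all choices are then properties of the
degree.

The degree is built analytically. For a continuous `φ` supported near a regular value, the integral
of `φ (f x) * det Df(x)` is the signed number of preimages times `∫ φ`. Along an affine homotopy its
derivative is a sum of integrals of determinants of three gradients, one factor being compactly
supported, and these vanish by integration by parts. So the count is homotopy invariant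
(`signedPreimageCount_eq_of_homotopy`). With Sard's lemma this gives existence of the degree,
constancy on connected sets, and dependence on the boundary values alone.

The last property allows `f` to be replaced by the cone over the surface with any apex `a`. The
preimages of `a + μ • w` under the cone correspond to the sheets that the ray from `a` meets beyond
parameter `μ`, with signs equal to crossing signs (`hasBrouwerDegree_of_ray`). Moving `μ` past a
simple point removes exactly one term; since the surface is tangent to a plane there, the same drop
occurs along every transverse path (`degree_jump`).

Cables exist by perturbation: in the family `y + t (z - y) + t (1 - t) w`, the `w` giving a tangency
are critical values of a map of three-space, and the `w` giving a passage through a multiple point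
form a set of dimension at most two. Both sets are null, so a suitable small `w` remains
(`exists_isCable`). -/

namespace CableIndex
open MeasureTheory Convolution ContinuousLinearMap

/-! ### Determinants of gradients are null Lagrangians -/

/-- The partial derivative of a scalar function on `ℝ³`. -/
noncomputable def pd (j : Fin 3) (f : E3 → ℝ) (x : E3) : ℝ :=
  fderiv ℝ f x (EuclideanSpace.single j 1)

theorem continuous_pd {f : E3 → ℝ} (hf : ContDiff ℝ 1 f) (j : Fin 3) : Continuous (pd j f) :=
  (hf.continuous_fderiv one_ne_zero).clm_apply continuous_const

theorem contDiff_pd {f : E3 → ℝ} (hf : ContDiff ℝ 2 f) (j : Fin 3) : ContDiff ℝ 1 (pd j f) :=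
  (hf.fderiv_right (m := 1) (by norm_num)).clm_apply contDiff_const

theorem hasCompactSupport_pd {f : E3 → ℝ} (hf : HasCompactSupport f) (j : Fin 3) :
    HasCompactSupport (pd j f) :=
  (hf.fderiv ℝ).comp_left (g := fun L : E3 →L[ℝ] ℝ => L (EuclideanSpace.single j 1)) rfl

theorem pd_comm {f : E3 → ℝ} (hf : ContDiff ℝ 2 f) (i j : Fin 3) (x : E3) :
    pd i (pd j f) x = pd j (pd i f) x := by
  have hd : DifferentiableAt ℝ (fderiv ℝ f) x :=
    ((hf.fderiv_right (m := 1) (by norm_num)).differentiable one_ne_zero).differentiableAt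
  have key : ∀ i j : Fin 3, pd i (pd j f) x =
      fderiv ℝ (fderiv ℝ f) x (EuclideanSpace.single i 1) (EuclideanSpace.single j 1) := by
    intro i j
    have : HasFDerivAt (pd j f)
        ((fderiv ℝ (fderiv ℝ f) x).flip (EuclideanSpace.single j 1)) x := by
      have := hd.hasFDerivAt.clm_apply (hasFDerivAt_const (EuclideanSpace.single j (1 : ℝ)) x)
      rwa [comp_zero, zero_add] at this
    rw [pd, this.fderiv]; rfl
  rw [key, key]
  exact (hf.contDiffAt.isSymmSndFDerivAt (by simp)).eq _ _

theorem pd_mul {f g : E3 → ℝ} {x : E3} (hf : DifferentiableAt ℝ f x)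
    (hg : DifferentiableAt ℝ g x) (j : Fin 3) :
    pd j (fun x => f x * g x) x = pd j f x * g x + f x * pd j g x := by
  unfold pd
  rw [fderiv_fun_mul hf hg]
  simp; ring

theorem pd_sub {f g : E3 → ℝ} {x : E3} (hf : DifferentiableAt ℝ f x)
    (hg : DifferentiableAt ℝ g x) (j : Fin 3) :
    pd j (fun x => f x - g x) x = pd j f x - pd j g x := by
  unfold pd
  rw [fderiv_fun_sub hf hg]
  simp

theorem pd_congr {f g : E3 → ℝ} {x : E3} (h : f =ᶠ[𝓝 x] g) (j : Fin 3) : pd j f x = pd j g x := by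
  unfold pd; rw [h.fderiv_eq]

/-- The determinant of three gradients. -/
noncomputable def jac3 (f g h : E3 → ℝ) (x : E3) : ℝ :=
  (pd 1 f x * pd 2 g x - pd 2 f x * pd 1 g x) * pd 0 h x +
  (pd 2 f x * pd 0 g x - pd 0 f x * pd 2 g x) * pd 1 h x +
  (pd 0 f x * pd 1 g x - pd 1 f x * pd 0 g x) * pd 2 h x

theorem integral_mul_pd {c w : E3 → ℝ} (hc : ContDiff ℝ 1 c) (hw : ContDiff ℝ 1 w)
    (hs : HasCompactSupport w) (j : Fin 3) :
    ∫ x, c x * pd j w x = - ∫ x, pd j c x * w x := by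
  apply integral_mul_fderiv_eq_neg_fderiv_mul_of_integrable
  · exact ((continuous_pd hc j).mul hw.continuous).integrable_of_hasCompactSupport hs.mul_left
  · exact (hc.continuous.mul (continuous_pd hw j)).integrable_of_hasCompactSupport
      (hasCompactSupport_pd hs j).mul_left
  · exact (hc.continuous.mul hw.continuous).integrable_of_hasCompactSupport hs.mul_left
  · exact fun x _ => (hc.differentiable one_ne_zero).differentiableAt
  · exact fun x _ => (hw.differentiable one_ne_zero).differentiableAt

/-- The integrand is `(∇f × ∇g) · ∇w`, and `∇f × ∇g` is divergence free because mixed second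
derivatives commute. Integrating by parts moves the derivative off `w`, which therefore needs only
to be `C¹`. -/
theorem integral_jac3_of_contDiff_two {f g w : E3 → ℝ} (hf : ContDiff ℝ 2 f) (hg : ContDiff ℝ 2 g)
    (hw : ContDiff ℝ 1 w) (hs : HasCompactSupport w) : ∫ x, jac3 f g w x = 0 := by
  have hF := contDiff_pd hf
  have hG := contDiff_pd hg
  have hc : ∀ i j, ContDiff ℝ 1 (fun x => pd i f x * pd j g x - pd j f x * pd i g x) :=
    fun i j => ((hF i).mul (hG j)).sub ((hF j).mul (hG i))
  have hint : ∀ i j k, Integrable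
      (fun x => (pd i f x * pd j g x - pd j f x * pd i g x) * pd k w x) := fun i j k =>
    ((hc i j).continuous.mul (continuous_pd hw k)).integrable_of_hasCompactSupport
      (hasCompactSupport_pd hs k).mul_left
  have hint' : ∀ i j k, Integrable
      (fun x => pd k (fun x => pd i f x * pd j g x - pd j f x * pd i g x) x * w x) := fun i j k =>
    ((continuous_pd (hc i j) k).mul hw.continuous).integrable_of_hasCompactSupport hs.mul_left
  have hd : ∀ i j k x, pd k (fun x => pd i f x * pd j g x - pd j f x * pd i g x) x =
      pd k (pd i f) x * pd j g x + pd i f x * pd k (pd j g) x -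
      (pd k (pd j f) x * pd i g x + pd j f x * pd k (pd i g) x) := by
    intro i j k x
    have e : ∀ i, DifferentiableAt ℝ (pd i f) x :=
      fun i => ((hF i).differentiable one_ne_zero).differentiableAt
    have e' : ∀ i, DifferentiableAt ℝ (pd i g) x :=
      fun i => ((hG i).differentiable one_ne_zero).differentiableAt
    rw [pd_sub ((e i).fun_mul (e' j)) ((e j).fun_mul (e' i)), pd_mul (e i) (e' j),
      pd_mul (e j) (e' i)]
  have hsum : ∀ {a b c : E3 → ℝ}, Integrable a → Integrable b → Integrable c →
      ∫ x, (a x + b x + c x) = (∫ x, a x) + (∫ x, b x) + ∫ x, c x := fun ha hb hc => by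
    rw [← integral_add ha hb]; exact integral_add (ha.add hb) hc
  unfold jac3
  rw [hsum (hint 1 2 0) (hint 2 0 1) (hint 0 1 2),
    integral_mul_pd (hc 1 2) hw hs, integral_mul_pd (hc 2 0) hw hs, integral_mul_pd (hc 0 1) hw hs,
    ← neg_add, ← neg_add, ← hsum (hint' 1 2 0) (hint' 2 0 1) (hint' 0 1 2), neg_eq_zero]
  rw [← integral_zero E3 ℝ]
  congr 1; funext x
  rw [hd, hd, hd, pd_comm hf 1 0, pd_comm hf 2 0, pd_comm hf 2 1, pd_comm hg 1 0, pd_comm hg 2 0,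
    pd_comm hg 2 1]
  ring

/-- Mollification of a compactly supported `C¹` function. -/
theorem exists_smooth_approx {f : E3 → ℝ} (hf : ContDiff ℝ 1 f) (hs : HasCompactSupport f) :
    ∃ (F : ℕ → E3 → ℝ) (M : ℝ), (∀ n, ContDiff ℝ 2 (F n)) ∧ (∀ n j x, ‖pd j (F n) x‖ ≤ M) ∧
      ∀ j x, Tendsto (fun n => pd j (F n) x) atTop (𝓝 (pd j f x)) := by
  let φ : ℕ → ContDiffBump (0 : E3) := fun n =>
    ⟨1 / ((n : ℝ) + 1) / 2, 1 / ((n : ℝ) + 1), by positivity, by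
      have : 0 < 1 / ((n : ℝ) + 1) := by positivity
      linarith⟩
  have hφ : Tendsto (fun n => (φ n).rOut) atTop (𝓝 0) := tendsto_one_div_add_atTop_nhds_zero_nat
  obtain ⟨C, hC⟩ : ∃ C, ∀ j x, ‖pd j f x‖ ≤ C := by
    have : ∀ j, ∃ C, ∀ x, ‖pd j f x‖ ≤ C := fun j =>
      (hasCompactSupport_pd hs j).exists_bound_of_continuous (continuous_pd hf j)
    choose C hC using this
    refine ⟨∑ j, |C j|, fun j x => (hC j x).trans ((le_abs_self _).trans ?_)⟩
    exact Finset.single_le_sum (f := fun j => |C j|) (fun i _ => abs_nonneg _) (Finset.mem_univ j)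
  have hli : ∀ n, LocallyIntegrable ((φ n).normed (volume : Measure E3)) := fun n =>
    ((φ n).contDiff_normed (n := 0)).continuous.locallyIntegrable
  have hpd : ∀ n j x, pd j ((φ n).normed volume ⋆[lsmul ℝ ℝ, volume] f) x =
      ((φ n).normed volume ⋆[lsmul ℝ ℝ, volume] pd j f) x := by
    intro n j x
    have h := hs.hasFDerivAt_convolution_right (lsmul ℝ ℝ) (hli n) hf x
    rw [pd, h.fderiv, convolution_precompR_apply _ (hli n) (hs.fderiv ℝ)
      (hf.continuous_fderiv one_ne_zero)]
    rfl
  refine ⟨fun n => (φ n).normed volume ⋆[lsmul ℝ ℝ, volume] f, 2 * C + C, fun n => ?_,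
    fun n j x => ?_, fun j x => ?_⟩
  · exact (φ n).hasCompactSupport_normed.contDiff_convolution_left _ (n := 2)
      (φ n).contDiff_normed hf.continuous.locallyIntegrable
  · rw [hpd]
    -- Two values of `pd j f` differ by at most `2 * C` anywhere, so the average is within `2 * C`
    -- of the value at `x`; this crude bound is uniform in `n`.
    have h := (φ n).dist_normed_convolution_le (μ := volume) (g := pd j f) (x₀ := x) (ε := 2 * C)
      (continuous_pd hf j).aestronglyMeasurable (fun y _ => by
        rw [dist_eq_norm]
        exact (norm_sub_le _ _).trans (by linarith [hC j x, hC j y]))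
    rw [dist_eq_norm] at h
    have := norm_le_norm_sub_add (((φ n).normed volume ⋆[lsmul ℝ ℝ, volume] pd j f) x) (pd j f x)
    linarith [hC j x]
  · simp only [hpd]
    exact ContDiffBump.convolution_tendsto_right_of_continuous hφ (continuous_pd hf j) x

/-- Only `f` and `g` are mollified. Their gradients converge pointwise and stay bounded, while the
gradient of `w` is integrable, so dominated convergence carries over the `C²` case. -/
theorem integral_jac3_of_hasCompactSupport {f g w : E3 → ℝ} (hf : ContDiff ℝ 1 f)
    (hg : ContDiff ℝ 1 g) (hw : ContDiff ℝ 1 w) (hfs : HasCompactSupport f)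
    (hgs : HasCompactSupport g) (hs : HasCompactSupport w) : ∫ x, jac3 f g w x = 0 := by
  obtain ⟨F, M, hF, hFM, hFt⟩ := exists_smooth_approx hf hfs
  obtain ⟨G, N, hG, hGN, hGt⟩ := exists_smooth_approx hg hgs
  have hM : 0 ≤ M := (norm_nonneg _).trans (hFM 0 0 0)
  have hN : 0 ≤ N := (norm_nonneg _).trans (hGN 0 0 0)
  have hlim : Tendsto (fun n => ∫ x, jac3 (F n) (G n) w x) atTop (𝓝 (∫ x, jac3 f g w x)) := by
    refine tendsto_integral_of_dominated_convergence
      (fun x => 2 * (M * N) * ‖pd 0 w x‖ + 2 * (M * N) * ‖pd 1 w x‖ + 2 * (M * N) * ‖pd 2 w x‖)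
      (fun n => ?_) ?_ (fun n => .of_forall fun x => ?_) (.of_forall fun x => ?_)
    · have c := continuous_pd ((hF n).of_le one_le_two)
      have c' := continuous_pd ((hG n).of_le one_le_two)
      have c'' := continuous_pd hw
      refine Continuous.aestronglyMeasurable ?_
      unfold jac3
      fun_prop
    · have : ∀ j, Integrable (fun x => 2 * (M * N) * ‖pd j w x‖) := fun j =>
        (((continuous_pd hw j).integrable_of_hasCompactSupport (hasCompactSupport_pd hs j)).norm
          ).const_mul _
      exact ((this 0).add (this 1)).add (this 2)
    · have key : ∀ i j k, ‖(pd i (F n) x * pd j (G n) x - pd j (F n) x * pd i (G n) x) * pd k w x‖ ≤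
          2 * (M * N) * ‖pd k w x‖ := by
        intro i j k
        rw [norm_mul]
        gcongr
        refine (norm_sub_le _ _).trans ?_
        rw [norm_mul, norm_mul, two_mul]
        gcongr <;> first | exact hFM _ _ _ | exact hGN _ _ _
      exact (norm_add₃_le).trans (add_le_add_three (key _ _ _) (key _ _ _) (key _ _ _))
    · have a := fun j => hFt j x
      have b := fun j => hGt j x
      unfold jac3
      exact ((((((a 1).mul (b 2)).sub ((a 2).mul (b 1))).mul_const _).add
        ((((a 2).mul (b 0)).sub ((a 0).mul (b 2))).mul_const _)).add
        ((((a 0).mul (b 1)).sub ((a 1).mul (b 0))).mul_const _))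
  have h0 : ∀ n, ∫ x, jac3 (F n) (G n) w x = 0 := fun n =>
    integral_jac3_of_contDiff_two (hF n) (hG n) hw hs
  simp only [h0] at hlim
  exact (tendsto_nhds_unique tendsto_const_nhds hlim).symm

theorem jac3_congr {f g w f' g' w' : E3 → ℝ} {x : E3} (hf : f =ᶠ[𝓝 x] f') (hg : g =ᶠ[𝓝 x] g')
    (hw : w =ᶠ[𝓝 x] w') : jac3 f g w x = jac3 f' g' w' x := by
  simp only [jac3, pd_congr hf, pd_congr hg, pd_congr hw]

theorem contDiff_mul_of_contDiffOn {U : Set E3} (hU : IsOpen U) {χ f : E3 → ℝ} {n : ℕ∞ω}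
    (hχ : ContDiff ℝ n χ) (hs : tsupport χ ⊆ U) (hf : ContDiffOn ℝ n f U) :
    ContDiff ℝ n (fun x => χ x * f x) := by
  rw [contDiff_iff_contDiffAt]
  intro x
  by_cases hx : x ∈ tsupport χ
  · exact hχ.contDiffAt.mul (hf.contDiffAt (hU.mem_nhds (hs hx)))
  · refine (contDiffAt_const (c := (0 : ℝ))).congr_of_eventuallyEq ?_
    filter_upwards [(isClosed_tsupport χ).isOpen_compl.mem_nhds hx] with y hy
    rw [image_eq_zero_of_notMem_tsupport hy, zero_mul]

theorem pd_eq_zero_of_notMem_tsupport {w : E3 → ℝ} {x : E3} (hx : x ∉ tsupport w) (j : Fin 3) :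
    pd j w x = 0 := by
  have : w =ᶠ[𝓝 x] fun _ => 0 := by
    filter_upwards [(isClosed_tsupport w).isOpen_compl.mem_nhds hx] with y hy
    exact image_eq_zero_of_notMem_tsupport hy
  rw [pd_congr this, pd]; simp

/-- The integral of the determinant of three gradients vanishes as soon as one of the functions is
compactly supported in the domain of the other two. -/
theorem integral_jac3_eq_zero {U : Set E3} (hU : IsOpen U) {f g w : E3 → ℝ}
    (hf : ContDiffOn ℝ 1 f U) (hg : ContDiffOn ℝ 1 g U) (hw : ContDiff ℝ 1 w)
    (hs : HasCompactSupport w) (hsU : tsupport w ⊆ U) : ∫ x, jac3 f g w x = 0 := by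
  -- Multiplying by a cutoff that is 1 near every point of `tsupport w` makes `f` and `g` global and
  -- compactly supported, and leaves their gradients unchanged wherever `∇w` can be nonzero.
  obtain ⟨χ, hχs, hχU, hχ, hχ1⟩ : ∃ χ : E3 → ℝ, HasCompactSupport χ ∧ tsupport χ ⊆ U ∧
      ContDiff ℝ 1 χ ∧ ∀ x ∈ tsupport w, χ =ᶠ[𝓝 x] fun _ => 1 := by
    obtain ⟨V, hVo, hKV, hVU, hVc⟩ := exists_open_between_and_isCompact_closure hs.isCompact hU hsU
    obtain ⟨W, hWo, hKW, hWV, -⟩ := exists_open_between_and_isCompact_closure hs.isCompact hVo hKV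
    obtain ⟨χ, h1, -, h3⟩ := exists_contMDiff_support_eq_eq_one_iff (I := 𝓘(ℝ, E3)) (n := 1) hVo
      isClosed_closure hWV
    have hts : tsupport χ = closure V := by rw [tsupport, h3.1]
    refine ⟨χ, ?_, hts ▸ hVU, h1.contDiff, fun x hx => ?_⟩
    · rw [HasCompactSupport, hts]; exact hVc
    · filter_upwards [hWo.mem_nhds (hKW hx)] with y hy
      exact (h3.2 y).1 (subset_closure hy)
  have h1 := integral_jac3_of_hasCompactSupport (contDiff_mul_of_contDiffOn hU hχ hχU hf)
    (contDiff_mul_of_contDiffOn hU hχ hχU hg) hw (hχs.mul_right) (hχs.mul_right) hs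
  rw [← h1]
  congr 1; funext x
  by_cases hx : x ∈ tsupport w
  · refine jac3_congr ?_ ?_ .rfl <;>
    · filter_upwards [hχ1 x hx] with y hy
      rw [hy, one_mul]
  · simp only [jac3, pd_eq_zero_of_notMem_tsupport hx, mul_zero]


/-! ### Homotopy invariance of the degree integral -/

/-- The determinant of three rows. -/
def det3 (a b c : Fin 3 → ℝ) : ℝ :=
  (a 1 * b 2 - a 2 * b 1) * c 0 + (a 2 * b 0 - a 0 * b 2) * c 1 + (a 0 * b 1 - a 1 * b 0) * c 2

/-- The coordinate functionals of `ℝ³`. -/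
noncomputable def coord (i : Fin 3) : E3 →L[ℝ] ℝ := EuclideanSpace.proj i

@[simp] theorem coord_apply (i : Fin 3) (x : E3) : coord i x = x i := rfl

/-- The rows of the matrix of an endomorphism of `ℝ³`. -/
noncomputable def row (A : E3 →L[ℝ] E3) (i j : Fin 3) : ℝ := A (EuclideanSpace.single j 1) i

theorem det_eq_det3 (A : E3 →L[ℝ] E3) : A.det = det3 (row A 0) (row A 1) (row A 2) := by
  have h : A.det = (LinearMap.toMatrix (EuclideanSpace.basisFun (Fin 3) ℝ).toBasis
      (EuclideanSpace.basisFun (Fin 3) ℝ).toBasis (A : E3 →ₗ[ℝ] E3)).det :=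
    (LinearMap.det_toMatrix _ _).symm
  rw [h, Matrix.det_fin_three]
  simp only [LinearMap.toMatrix_apply, OrthonormalBasis.coe_toBasis,
    EuclideanSpace.basisFun_apply, OrthonormalBasis.coe_toBasis_repr_apply,
    EuclideanSpace.basisFun_repr, det3, row, ContinuousLinearMap.coe_coe]
  ring

theorem pd_apply {h : E3 → E3} {x : E3} (hh : DifferentiableAt ℝ h x) (i j : Fin 3) :
    pd j (fun y => h y i) x = row (fderiv ℝ h x) i j := by
  have := (coord i).hasFDerivAt.comp x
    hh.hasFDerivAt
  unfold pd
  rw [show (fun y => h y i) = (coord i) ∘ h from rfl,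
    this.fderiv]
  rfl

theorem sum_single (v : E3) : v = ∑ k, v k • EuclideanSpace.single k (1 : ℝ) := by
  simpa using ((EuclideanSpace.basisFun (Fin 3) ℝ).sum_repr v).symm

theorem clm_apply_eq_sum (L : E3 →L[ℝ] ℝ) (v : E3) :
    L v = ∑ k, v k * L (EuclideanSpace.single k 1) := by
  conv_lhs => rw [sum_single v]
  simp

theorem pd_comp {φ : E3 → ℝ} {h : E3 → E3} {x : E3} (hφ : DifferentiableAt ℝ φ (h x))
    (hh : DifferentiableAt ℝ h x) (j : Fin 3) :
    pd j (fun y => φ (h y)) x = ∑ k, row (fderiv ℝ h x) k j * pd k φ (h x) := by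
  have := hφ.hasFDerivAt.comp x hh.hasFDerivAt
  unfold pd
  rw [show (fun y => φ (h y)) = φ ∘ h from rfl, this.fderiv,
    ContinuousLinearMap.comp_apply, clm_apply_eq_sum]
  rfl

theorem row_add_smul (A B : E3 →L[ℝ] E3) (s : ℝ) (i : Fin 3) :
    row (A + s • B) i = row A i + s • row B i := by
  ext j; simp [row]

/-- The derivative in `s` of `φ (v + s u) * det (A + s B)`. -/
noncomputable def homDeriv (φ : E3 → ℝ) (v u : E3) (A B : E3 →L[ℝ] E3) (s : ℝ) : ℝ :=
  fderiv ℝ φ (v + s • u) u * (A + s • B).det + φ (v + s • u) *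
    (det3 (row B 0) (row (A + s • B) 1) (row (A + s • B) 2) +
     det3 (row (A + s • B) 0) (row B 1) (row (A + s • B) 2) +
     det3 (row (A + s • B) 0) (row (A + s • B) 1) (row B 2))

theorem hasDerivAt_homotopy {φ : E3 → ℝ} (hφ : Differentiable ℝ φ) (v u : E3) (A B : E3 →L[ℝ] E3)
    (s : ℝ) : HasDerivAt (fun s : ℝ => φ (v + s • u) * (A + s • B).det) (homDeriv φ v u A B s) s :=
    by
  have h1 : HasDerivAt (fun s : ℝ => φ (v + s • u)) (fderiv ℝ φ (v + s • u) u) s := by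
    have : HasDerivAt (fun s : ℝ => v + s • u) u s := by
      simpa using ((hasDerivAt_id s).smul_const u).const_add v
    exact (hφ _).hasFDerivAt.comp_hasDerivAt s this
  refine h1.mul ?_
  have h2 : ∀ i j, HasDerivAt (fun s : ℝ => row (A + s • B) i j) (row B i j) s := by
    intro i j
    simp only [row_add_smul, Pi.add_apply, Pi.smul_apply, smul_eq_mul]
    simpa using ((hasDerivAt_id s).mul_const (row B i j)).const_add (row A i j)
  simp only [det_eq_det3]
  have h3 := (((((h2 0 1).mul (h2 1 2)).sub ((h2 0 2).mul (h2 1 1))).mul (h2 2 0)).add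
    ((((h2 0 2).mul (h2 1 0)).sub ((h2 0 0).mul (h2 1 2))).mul (h2 2 1))).add
    ((((h2 0 0).mul (h2 1 1)).sub ((h2 0 1).mul (h2 1 0))).mul (h2 2 2))
  refine h3.congr_deriv ?_
  simp only [det3, Pi.mul_apply, Pi.sub_apply]
  ring

theorem continuousOn_row {X : Type*} [TopologicalSpace X] {S : Set X} {L : X → E3 →L[ℝ] E3}
    (hL : ContinuousOn L S) (i j : Fin 3) : ContinuousOn (fun p => row (L p) i j) S :=
  (coord i).continuous.comp_continuousOn (hL.clm_apply continuousOn_const)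

theorem continuousOn_det3 {X : Type*} [TopologicalSpace X] {S : Set X} {a b c : X → Fin 3 → ℝ}
    (ha : ∀ j, ContinuousOn (fun p => a p j) S) (hb : ∀ j, ContinuousOn (fun p => b p j) S)
    (hc : ∀ j, ContinuousOn (fun p => c p j) S) :
    ContinuousOn (fun p => det3 (a p) (b p) (c p)) S :=
  (((((ha 1).mul (hb 2)).sub ((ha 2).mul (hb 1))).mul (hc 0)).add
    ((((ha 2).mul (hb 0)).sub ((ha 0).mul (hb 2))).mul (hc 1))).add
    ((((ha 0).mul (hb 1)).sub ((ha 1).mul (hb 0))).mul (hc 2))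

theorem continuousOn_homDeriv {X : Type*} [TopologicalSpace X] {S : Set X} {φ : E3 → ℝ}
    (hφ : ContDiff ℝ 1 φ) {v u : X → E3} {A B : X → E3 →L[ℝ] E3} {s : X → ℝ}
    (hv : ContinuousOn v S) (hu : ContinuousOn u S) (hA : ContinuousOn A S)
    (hB : ContinuousOn B S) (hs : ContinuousOn s S) :
    ContinuousOn (fun p => homDeriv φ (v p) (u p) (A p) (B p) (s p)) S := by
  have ch := hv.add (hs.smul hu)
  have cA := hA.add (hs.smul hB)
  have rA := continuousOn_row cA
  have rB := continuousOn_row hB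
  exact ((((hφ.continuous_fderiv one_ne_zero).comp_continuousOn ch).clm_apply hu).mul
    (ContinuousLinearMap.continuous_det.comp_continuousOn cA)).add
    ((hφ.continuous.comp_continuousOn ch).mul
    (((continuousOn_det3 (rB 0) (rA 1) (rA 2)).add (continuousOn_det3 (rA 0) (rB 1) (rA 2))).add
      (continuousOn_det3 (rA 0) (rA 1) (rB 2))))

/-- The derivative of the degree integrand along an affine homotopy is a sum of null Lagrangians. -/
theorem homDeriv_eq_jac3 {φ : E3 → ℝ} (hφ : Differentiable ℝ φ) {f u : E3 → E3} {x : E3}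
    (hf : DifferentiableAt ℝ f x) (hu : DifferentiableAt ℝ u x) (s : ℝ) :
    homDeriv φ (f x) (u x) (fderiv ℝ f x) (fderiv ℝ u x) s =
      jac3 (fun y => (f y + s • u y) 0) (fun y => (f y + s • u y) 1)
        (fun y => φ (f y + s • u y) * u y 2) x +
      jac3 (fun y => (f y + s • u y) 1) (fun y => (f y + s • u y) 2)
        (fun y => φ (f y + s • u y) * u y 0) x +
      jac3 (fun y => (f y + s • u y) 2) (fun y => (f y + s • u y) 0)
        (fun y => φ (f y + s • u y) * u y 1) x := by
  have hh : DifferentiableAt ℝ (fun y => f y + s • u y) x := hf.add (hu.const_smul s)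
  have hφh : DifferentiableAt ℝ (fun y => φ (f y + s • u y)) x := (hφ _).comp x hh
  have hui : ∀ i, DifferentiableAt ℝ (fun y => u y i) x := fun i =>
    (coord i).differentiableAt.comp x hu
  have hfd : fderiv ℝ (fun y => f y + s • u y) x = fderiv ℝ f x + s • fderiv ℝ u x := by
    rw [fderiv_fun_add hf (hu.fun_const_smul s), fderiv_fun_const_smul hu]
  -- Put `h = f + s • u`. In the gradient of `φ(h) u_k`, the part `φ(h) ∇u_k` gives the derivative
  -- of the determinant in row `k`. The part `u_k ∇(φ ∘ h)` is a combination of the rows of `Dh`, of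
  -- which only row `k` survives next to the other two; it gives `u_k ∂_kφ · det Dh`.
  have e1 : ∀ i j, pd j (fun y => (f y + s • u y) i) x =
      row (fderiv ℝ f x + s • fderiv ℝ u x) i j := fun i j => by rw [pd_apply hh, hfd]
  have e2 : ∀ i j, pd j (fun y => φ (f y + s • u y) * u y i) x =
      (∑ k, row (fderiv ℝ f x + s • fderiv ℝ u x) k j * pd k φ (f x + s • u x)) * u x i +
        φ (f x + s • u x) * row (fderiv ℝ u x) i j := fun i j => by
    rw [pd_mul hφh (hui i), pd_comp (hφ _) hh, hfd, pd_apply hu]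
  have e3 : fderiv ℝ φ (f x + s • u x) (u x) = ∑ k, u x k * pd k φ (f x + s • u x) :=
    clm_apply_eq_sum _ _
  simp only [jac3, e1, e2, homDeriv, e3, det_eq_det3, Fin.sum_univ_three]
  generalize row (fderiv ℝ f x + s • fderiv ℝ u x) = H
  generalize row (fderiv ℝ u x) = B
  simp only [det3]
  ring

section

variable {U : Set E3} {f u : E3 → E3} {φ : E3 → ℝ}

/-- The points of the closure of `U` that some stage of the homotopy moves into the support. -/
def homSupport (U : Set E3) (f u : E3 → E3) (φ : E3 → ℝ) : Set E3 :=
  {x | x ∈ closure U ∧ ∃ s ∈ Icc (0 : ℝ) 1, f x + s • u x ∈ tsupport φ}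

theorem isCompact_homSupport (hb : Bornology.IsBounded U) (hf : ContinuousOn f (closure U))
    (hu : ContinuousOn u (closure U)) : IsCompact (homSupport U f u φ) := by
  have hc : IsCompact (closure U ×ˢ Icc (0 : ℝ) 1) := hb.isCompact_closure.prod isCompact_Icc
  have hcont : ContinuousOn (fun p : E3 × ℝ => f p.1 + p.2 • u p.1) (closure U ×ˢ Icc (0 : ℝ) 1) :=
    (hf.comp continuousOn_fst fun p hp => hp.1).add
      (continuousOn_snd.smul (hu.comp continuousOn_fst fun p hp => hp.1))
  have h := (hc.of_isClosed_subset
    (hcont.preimage_isClosed_of_isClosed hc.isClosed (isClosed_tsupport φ)) inter_subset_left).image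
    continuous_fst
  convert h using 1
  ext x
  simp only [homSupport, mem_ofPred_eq, mem_image, mem_inter_iff, mem_prod, mem_preimage,
    Prod.exists, exists_and_right, exists_eq_right]
  constructor
  · rintro ⟨h1, s, h2, h3⟩; exact ⟨s, ⟨h1, h2⟩, h3⟩
  · rintro ⟨s, ⟨h1, h2⟩, h3⟩; exact ⟨h1, s, h2, h3⟩

theorem homSupport_subset (hU : IsOpen U)
    (h : ∀ s ∈ Icc (0 : ℝ) 1, ∀ x ∈ frontier U, f x + s • u x ∉ tsupport φ) :
    homSupport U f u φ ⊆ U := by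
  rintro x ⟨hx, s, hs, hxs⟩
  by_contra hxU
  exact h s hs x ⟨hx, by rwa [hU.interior_eq]⟩ hxs

/-- By `homDeriv_eq_jac3` the integrand is a sum of three null Lagrangians, each with a factor
containing `φ (f + s • u)`. Since the boundary never enters the support of `φ`, that factor is
compactly supported inside `U`. -/
theorem integral_homDeriv_eq_zero (hU : IsOpen U) (hb : Bornology.IsBounded U)
    (hf : ContinuousOn f (closure U)) (hf' : ContDiffOn ℝ 1 f U)
    (hu : ContinuousOn u (closure U)) (hu' : ContDiffOn ℝ 1 u U) (hφ : ContDiff ℝ 1 φ)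
    (h : ∀ s ∈ Icc (0 : ℝ) 1, ∀ x ∈ frontier U, f x + s • u x ∉ tsupport φ)
    {s : ℝ} (hs : s ∈ Icc (0 : ℝ) 1) :
    ∫ x in homSupport U f u φ, homDeriv φ (f x) (u x) (fderiv ℝ f x) (fderiv ℝ u x) s = 0 := by
  set K := homSupport U f u φ with hK
  have hKc : IsCompact K := isCompact_homSupport hb hf hu
  have hKU : K ⊆ U := homSupport_subset hU h
  have hh : ContDiffOn ℝ 1 (fun y => f y + s • u y) U := hf'.add (hu'.const_smul s)
  have hcoord : ∀ {g : E3 → E3}, ContDiffOn ℝ 1 g U → ∀ i, ContDiffOn ℝ 1 (fun y => g y i) U :=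
    fun hg i => (coord i).contDiff.comp_contDiffOn hg
  -- Extension by zero is harmless: the product already vanishes on `U` outside the compact set `K`,
  -- so the extension is globally `C¹`.
  let w : Fin 3 → E3 → ℝ := fun i => U.indicator fun y => φ (f y + s • u y) * u y i
  have hwU : ∀ i, ∀ x ∈ U, w i =ᶠ[𝓝 x] fun y => φ (f y + s • u y) * u y i := fun i x hx => by
    filter_upwards [hU.mem_nhds hx] with y hy using indicator_of_mem hy _
  have hwK : ∀ i, ∀ x ∉ K, w i x = 0 := fun i x hx => by
    by_cases hxU : x ∈ U
    · simp only [w, indicator_of_mem hxU]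
      rw [image_eq_zero_of_notMem_tsupport (f := φ)
        fun hh => hx ⟨subset_closure hxU, s, hs, hh⟩, zero_mul]
    · exact indicator_of_notMem hxU _
  have hwts : ∀ i, tsupport (w i) ⊆ K := fun i =>
    closure_minimal (fun x hx => by_contra fun hxK => hx (hwK i x hxK)) hKc.isClosed
  have hws : ∀ i, HasCompactSupport (w i) := fun i =>
    hKc.of_isClosed_subset (isClosed_tsupport _) (hwts i)
  have hwd : ∀ i, ContDiff ℝ 1 (w i) := fun i => contDiff_iff_contDiffAt.2 fun x => by
    by_cases hx : x ∈ K
    · have hxU := hU.mem_nhds (hKU hx)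
      refine ContDiffAt.congr_of_eventuallyEq ?_ (hwU i x (hKU hx))
      exact (hφ.contDiffAt.comp x (hh.contDiffAt hxU)).mul ((hcoord hu' i).contDiffAt hxU)
    · refine (contDiffAt_const (c := (0 : ℝ))).congr_of_eventuallyEq ?_
      filter_upwards [hKc.isClosed.isOpen_compl.mem_nhds hx] with y hy using hwK i y hy
  have hz : ∀ i j k,
      ∫ x, jac3 (fun y => (f y + s • u y) i) (fun y => (f y + s • u y) j) (w k) x = 0 :=
    fun i j k => integral_jac3_eq_zero hU (hcoord hh i) (hcoord hh j) (hwd k) (hws k)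
      ((hwts k).trans hKU)
  have hzK : ∀ i j k, ∀ x ∉ K,
      jac3 (fun y => (f y + s • u y) i) (fun y => (f y + s • u y) j) (w k) x = 0 :=
    fun i j k x hx => by
    simp only [jac3, pd_eq_zero_of_notMem_tsupport fun hh => hx (hwts k hh), mul_zero, add_zero]
  have hpc : ∀ i j, ContinuousOn (pd j fun y => (f y + s • u y) i) K := fun i j =>
    (((hcoord hh i).continuousOn_fderiv_of_isOpen hU le_rfl).clm_apply continuousOn_const).mono hKU
  have hint : ∀ i j k, IntegrableOn
      (jac3 (fun y => (f y + s • u y) i) (fun y => (f y + s • u y) j) (w k)) K := fun i j k => by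
    refine ContinuousOn.integrableOn_compact hKc ?_
    have c1 := hpc i
    have c2 := hpc j
    have c3 := fun l => (continuous_pd (hwd k) l).continuousOn (s := K)
    exact continuousOn_det3 (a := fun x l => pd l (fun y => (f y + s • u y) i) x)
      (b := fun x l => pd l (fun y => (f y + s • u y) j) x) (c := fun x l => pd l (w k) x) c1 c2 c3
  have hz' : ∀ i j k,
      ∫ x in K, jac3 (fun y => (f y + s • u y) i) (fun y => (f y + s • u y) j) (w k) x = 0 :=
    fun i j k => by
      rw [setIntegral_eq_integral_of_forall_compl_eq_zero (hzK i j k), hz]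
  have hsum := integral_add ((hint 0 1 2).add (hint 1 2 0)) (hint 2 0 1)
  have hsum' := integral_add (hint 0 1 2) (hint 1 2 0)
  simp only [hz', add_zero] at hsum'
  simp only [Pi.add_apply, hsum', hz', add_zero] at hsum
  rw [← hsum]
  refine setIntegral_congr_fun hKc.measurableSet fun x hx => ?_
  have hxU := hU.mem_nhds (hKU hx)
  beta_reduce
  rw [homDeriv_eq_jac3 (hφ.differentiable one_ne_zero)
    ((hf'.contDiffAt hxU).differentiableAt one_ne_zero)
    ((hu'.contDiffAt hxU).differentiableAt one_ne_zero)]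
  rw [jac3_congr .rfl .rfl (hwU 2 x (hKU hx)), jac3_congr .rfl .rfl (hwU 0 x (hKU hx)),
    jac3_congr .rfl .rfl (hwU 1 x (hKU hx))]

/-- The integral of `φ (f x) * det Df(x)` is invariant under affine homotopies along which the
boundary stays away from the support of `φ`. -/
theorem integral_degree_homotopy (hU : IsOpen U) (hb : Bornology.IsBounded U)
    (hf : ContinuousOn f (closure U)) (hf' : ContDiffOn ℝ 1 f U)
    (hu : ContinuousOn u (closure U)) (hu' : ContDiffOn ℝ 1 u U) (hφ : ContDiff ℝ 1 φ)
    (h : ∀ s ∈ Icc (0 : ℝ) 1, ∀ x ∈ frontier U, f x + s • u x ∉ tsupport φ) :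
    ∫ x in U, φ (f x + u x) * (fderiv ℝ f x + fderiv ℝ u x).det =
      ∫ x in U, φ (f x) * (fderiv ℝ f x).det := by
  set K := homSupport U f u φ with hK
  have hKc : IsCompact K := isCompact_homSupport hb hf hu
  have hKU : K ⊆ U := homSupport_subset hU h
  have hφd := hφ.differentiable one_ne_zero
  set e : ℝ → E3 → ℝ := fun s x => φ (f x + s • u x) * (fderiv ℝ f x + s • fderiv ℝ u x).det with he
  have hUK : ∀ s ∈ Icc (0 : ℝ) 1, ∫ x in U, e s x = ∫ x in K, e s x := fun s hs => by
    refine setIntegral_eq_of_subset_of_forall_sdiff_eq_zero hU.measurableSet hKU fun x hx => ?_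
    simp only [he]
    rw [image_eq_zero_of_notMem_tsupport (f := φ)
      fun hh => hx.2 ⟨subset_closure hx.1, s, hs, hh⟩, zero_mul]
  have h1 : ∫ x in U, φ (f x + u x) * (fderiv ℝ f x + fderiv ℝ u x).det = ∫ x in K, e 1 x := by
    rw [← hUK 1 (by simp)]; simp [he]
  have h0 : ∫ x in U, φ (f x) * (fderiv ℝ f x).det = ∫ x in K, e 0 x := by
    rw [← hUK 0 (by simp)]
    simp only [he, zero_smul ℝ (_ : E3), zero_smul ℝ (_ : E3 →L[ℝ] E3), add_zero]
  rw [h1, h0, ← sub_eq_zero]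
  have cf : ContinuousOn f K := hf'.continuousOn.mono hKU
  have cu : ContinuousOn u K := hu'.continuousOn.mono hKU
  have cf' : ContinuousOn (fderiv ℝ f) K :=
    (hf'.continuousOn_fderiv_of_isOpen hU le_rfl).mono hKU
  have cu' : ContinuousOn (fderiv ℝ u) K :=
    (hu'.continuousOn_fderiv_of_isOpen hU le_rfl).mono hKU
  have ce : ∀ s, IntegrableOn (e s) K := fun s => by
    refine ContinuousOn.integrableOn_compact hKc ?_
    exact (hφ.continuous.comp_continuousOn (cf.add (cu.const_smul s))).mul
      (ContinuousLinearMap.continuous_det.comp_continuousOn (cf'.add (cu'.const_smul s)))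
  set d : ℝ → E3 → ℝ := fun s x => homDeriv φ (f x) (u x) (fderiv ℝ f x) (fderiv ℝ u x) s with hd
  have cdd : ContinuousOn (Function.uncurry d) (Icc (0 : ℝ) 1 ×ˢ K) := by
    have m : MapsTo Prod.snd (Icc (0 : ℝ) 1 ×ˢ K) K := fun p hp => hp.2
    exact continuousOn_homDeriv hφ (cf.comp continuousOn_snd m) (cu.comp continuousOn_snd m)
      (cf'.comp continuousOn_snd m) (cu'.comp continuousOn_snd m) continuousOn_fst
  have hdi : Integrable (Function.uncurry d)
      ((volume.restrict (Icc (0 : ℝ) 1)).prod (volume.restrict K)) := by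
    rw [Measure.prod_restrict]
    exact cdd.integrableOn_compact (isCompact_Icc.prod hKc)
  have hFTC : ∀ x ∈ K, e 1 x - e 0 x = ∫ s in Icc (0 : ℝ) 1, d s x := fun x hx => by
    rw [integral_Icc_eq_integral_Ioc, ← intervalIntegral.integral_of_le zero_le_one]
    symm
    refine intervalIntegral.integral_eq_sub_of_hasDerivAt (f := fun s => e s x)
      (fun s _ => hasDerivAt_homotopy hφd _ _ _ _ s) ?_
    refine ContinuousOn.intervalIntegrable ?_
    rw [uIcc_of_le zero_le_one]
    exact cdd.comp (by fun_prop : Continuous fun s : ℝ => (s, x)).continuousOn fun s hs => ⟨hs, hx⟩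
  -- The difference of the two ends is a double integral over `K` and `[0, 1]`; after Fubini the
  -- inner integral over `K` vanishes for every `s`.
  rw [← integral_sub (ce 1) (ce 0), setIntegral_congr_fun hKc.measurableSet hFTC,
    ← integral_integral_swap hdi]
  rw [setIntegral_congr_fun measurableSet_Icc (g := fun _ => (0 : ℝ)) fun s hs =>
    integral_homDeriv_eq_zero hU hb hf hf' hu hu' hφ h hs]
  simp

end


/-! ### The Brouwer degree -/

/-- The inverse function theorem together with continuity of the determinant; it provides the
neighbourhoods on which the change of variables formula is applied. -/
theorem exists_open_injOn_sign_eq {f : E3 → E3} {x : E3} (hf : ContDiffAt ℝ 1 f x)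
    (hdet : (fderiv ℝ f x).det ≠ 0) {W : Set E3} (hW : W ∈ 𝓝 x) :
    ∃ V ⊆ W, IsOpen V ∧ x ∈ V ∧ InjOn f V ∧ IsOpen (f '' V) ∧
      ∀ y ∈ V, SignType.sign (fderiv ℝ f y).det = SignType.sign (fderiv ℝ f x).det := by
  let L := (fderiv ℝ f x).toContinuousLinearEquivOfDetNeZero hdet
  have hL : HasFDerivAt f (L : E3 →L[ℝ] E3) x := by
    simpa [L] using (hf.differentiableAt one_ne_zero).hasFDerivAt
  let e := hf.toOpenPartialHomeomorph f hL one_ne_zero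
  have hxe : x ∈ e.source := hf.mem_toOpenPartialHomeomorph_source hL one_ne_zero
  have hs : ∀ᶠ y in 𝓝 x,
      SignType.sign (fderiv ℝ f y).det = SignType.sign (fderiv ℝ f x).det := by
    have hc : ContinuousAt (fun y => (fderiv ℝ f y).det) x :=
      ContinuousLinearMap.continuous_det.continuousAt.comp
        (hf.continuousAt_fderiv one_ne_zero)
    exact (continuousAt_sign_of_ne_zero hdet).tendsto.comp hc.tendsto
      ((isOpen_discrete {SignType.sign (fderiv ℝ f x).det}).mem_nhds rfl)
  obtain ⟨V, hV, hVo, hxV⟩ := _root_.mem_nhds_iff.1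
    (inter_mem (inter_mem hW hs) (e.open_source.mem_nhds hxe))
  refine ⟨V, fun y hy => (hV hy).1.1, hVo, hxV, ?_, ?_, fun y hy => (hV hy).1.2⟩
  · exact e.injOn.mono fun y hy => (hV hy).2
  · exact e.isOpen_image_of_subset_source hVo fun y hy => (hV hy).2

section

variable {U : Set E3} {f g : E3 → E3} {z : E3}

theorem frontier_eq_closure_sdiff (hU : IsOpen U) : frontier U = closure U \ U := by
  rw [frontier, hU.interior_eq]

theorem isCompact_preimage (hU : IsOpen U) (hb : Bornology.IsBounded U)
    (hf : ContinuousOn f (closure U)) (hz : z ∉ f '' frontier U) :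
    IsCompact {x | x ∈ U ∧ f x = z} := by
  have h := hf.preimage_isClosed_of_isClosed isClosed_closure (isClosed_singleton (x := z))
  have : {x | x ∈ U ∧ f x = z} = closure U ∩ f ⁻¹' {z} := by
    ext x
    refine ⟨fun hx => ⟨subset_closure hx.1, hx.2⟩, fun hx => ⟨?_, hx.2⟩⟩
    by_contra hxU
    exact hz ⟨x, by rw [frontier_eq_closure_sdiff hU]; exact ⟨hx.1, hxU⟩, hx.2⟩
  rw [this]
  exact hb.isCompact_closure.of_isClosed_subset h inter_subset_left

theorem finite_preimage (hU : IsOpen U) (hb : Bornology.IsBounded U)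
    (hf : ContinuousOn f (closure U)) (hf' : ContDiffOn ℝ 1 f U) (hz : IsRegularValueOn f U z) :
    {x | x ∈ U ∧ f x = z}.Finite := by
  have hK := isCompact_preimage hU hb hf hz.1
  refine hK.finite (isDiscrete_iff_forall_mem_exists_isOpen.2 fun x hx => ?_)
  obtain ⟨V, -, hVo, hxV, hinj, -, -⟩ := exists_open_injOn_sign_eq
    (hf'.contDiffAt (hU.mem_nhds hx.1)) (hz.2 x hx.1 hx.2) univ_mem
  refine ⟨V, hVo, ?_⟩
  ext y
  simp only [mem_inter_iff, mem_ofPred_eq, mem_singleton_iff]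
  constructor
  · rintro ⟨h1, h2, h3⟩
    exact hinj h1 hxV (h3.trans hx.2.symm)
  · rintro rfl; exact ⟨hxV, hx⟩

/-- Near a regular value the degree integral counts preimages with sign. -/
theorem exists_integral_eq_signedPreimageCount (hU : IsOpen U) (hb : Bornology.IsBounded U)
    (hf : ContinuousOn f (closure U)) (hf' : ContDiffOn ℝ 1 f U) (hz : IsRegularValueOn f U z) :
    ∃ ε > 0, ∀ φ : E3 → ℝ, Continuous φ → Function.support φ ⊆ ball z ε →
      ∫ x in U, φ (f x) * (fderiv ℝ f x).det = signedPreimageCount f U z * ∫ y, φ y := by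
  have hfin := finite_preimage hU hb hf hf' hz
  obtain ⟨W, hW, hWd⟩ := hfin.t2_separation
  set S : Finset E3 := hfin.toFinset with hS
  have hSm : ∀ {x}, x ∈ S ↔ x ∈ U ∧ f x = z := fun {x} => by simp [hS]
  have hloc : ∀ x : S, ∃ V ⊆ W x ∩ U, IsOpen V ∧ x.1 ∈ V ∧ InjOn f V ∧ IsOpen (f '' V) ∧
      ∀ y ∈ V, SignType.sign (fderiv ℝ f y).det = SignType.sign (fderiv ℝ f x).det := fun x => by
    have hx := hSm.1 x.2
    exact exists_open_injOn_sign_eq (hf'.contDiffAt (hU.mem_nhds hx.1)) (hz.2 x hx.1 hx.2)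
      (inter_mem ((hW x).2.mem_nhds (hW x).1) (hU.mem_nhds hx.1))
  choose V hVW hVo hxV hinj hopen hsign using hloc
  have hdisj : Pairwise (Function.onFun Disjoint V) := fun x y hxy =>
    (hWd (hSm.1 x.2) (hSm.1 y.2) (fun h => hxy (Subtype.ext h))).mono
      ((hVW x).trans inter_subset_left) ((hVW y).trans inter_subset_left)
  have hVU : ∀ x, V x ⊆ U := fun x => (hVW x).trans inter_subset_right
  -- away from the chosen neighbourhoods the values stay away from `z`
  have hrest : IsCompact (f '' (closure U \ ⋃ x, V x)) :=
    (hb.isCompact_closure.diff (isOpen_iUnion hVo)).image_of_continuousOn (hf.mono sdiff_subset)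
  have hzrest : z ∉ f '' (closure U \ ⋃ x, V x) := by
    rintro ⟨x, ⟨hx, hxV'⟩, hfx⟩
    by_cases hxU : x ∈ U
    · exact hxV' (mem_iUnion.2 ⟨⟨x, hSm.2 ⟨hxU, hfx⟩⟩, hxV ⟨x, hSm.2 ⟨hxU, hfx⟩⟩⟩)
    · exact hz.1 ⟨x, by rw [frontier_eq_closure_sdiff hU]; exact ⟨hx, hxU⟩, hfx⟩
  -- A ball inside this set is covered once by each `V x` and not at all by the rest of `closure U`,
  -- so each preimage contributes the full integral of `φ` with its sign.
  have hN : (f '' (closure U \ ⋃ x, V x))ᶜ ∩ ⋂ x, f '' V x ∈ 𝓝 z := by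
    refine inter_mem (hrest.isClosed.isOpen_compl.mem_nhds hzrest) ((iInter_mem).2 fun x => ?_)
    exact (hopen x).mem_nhds ⟨x, hxV x, (hSm.1 x.2).2⟩
  obtain ⟨ε, hε, hball⟩ := Metric.mem_nhds_iff.1 hN
  refine ⟨ε, hε, fun φ hφ hsupp => ?_⟩
  have hφi : Integrable φ := hφ.integrable_of_hasCompactSupport <|
    (isCompact_closedBall z ε).of_isClosed_subset (isClosed_tsupport φ)
      (closure_minimal (hsupp.trans ball_subset_closedBall) isClosed_closedBall)
  have hder : ∀ x, ∀ y ∈ V x, HasFDerivWithinAt f (fderiv ℝ f y) (V x) y := fun x y hy =>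
    ((hf'.contDiffAt (hU.mem_nhds (hVU x hy))).differentiableAt
      one_ne_zero).hasFDerivAt.hasFDerivWithinAt
  have habs : ∀ x : S, ∀ y ∈ V x, φ (f y) * (fderiv ℝ f y).det =
      (SignType.sign (fderiv ℝ f x).det : ℝ) * (|(fderiv ℝ f y).det| • φ (f y)) := fun x y hy => by
    rw [← hsign x y hy, smul_eq_mul, ← mul_assoc, sign_mul_abs, mul_comm]
  have hVint : ∀ x : S, ∫ y in V x, φ (f y) * (fderiv ℝ f y).det =
      (SignType.sign (fderiv ℝ f x).det : ℝ) * ∫ y, φ y := fun x => by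
    rw [setIntegral_congr_fun (hVo x).measurableSet (habs x), integral_const_mul,
      ← integral_image_eq_integral_abs_det_fderiv_smul volume (hVo x).measurableSet (hder x)
        (hinj x), setIntegral_eq_integral_of_forall_compl_eq_zero]
    intro y hy
    by_contra hne
    exact hy (mem_iInter.1 (hball (hsupp hne)).2 x)
  have hVi : ∀ x : S, IntegrableOn (fun y => φ (f y) * (fderiv ℝ f y).det) (V x) := fun x => by
    rw [integrableOn_congr_fun (habs x) (hVo x).measurableSet]
    exact ((integrableOn_image_iff_integrableOn_abs_det_fderiv_smul volume (hVo x).measurableSet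
      (hder x) (hinj x) φ).1 hφi.integrableOn).const_mul _
  have hUV : ∫ x in U, φ (f x) * (fderiv ℝ f x).det =
      ∫ x in ⋃ x, V x, φ (f x) * (fderiv ℝ f x).det := by
    refine setIntegral_eq_of_subset_of_forall_sdiff_eq_zero hU.measurableSet (iUnion_subset hVU)
      fun x hx => ?_
    have : φ (f x) = 0 := by
      by_contra hne
      exact (hball (hsupp hne)).1 ⟨x, ⟨subset_closure hx.1, hx.2⟩, rfl⟩
    rw [this, zero_mul]
  have hcount : (signedPreimageCount f U z : ℝ) =
      ∑ x : S, (SignType.sign (fderiv ℝ f x).det : ℝ) := by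
    rw [signedPreimageCount, finsum_mem_eq_finite_toFinset_sum _ hfin, Int.cast_sum,
      ← Finset.sum_coe_sort]
    refine Finset.sum_congr rfl fun x _ => ?_
    cases SignType.sign (fderiv ℝ f x).det <;> simp
  rw [hUV, integral_iUnion_fintype (fun x => (hVo x).measurableSet) hdisj hVi, hcount,
    Finset.sum_mul]
  exact Finset.sum_congr rfl fun x _ => hVint x

/-- The algebraic number of preimages is invariant under affine homotopies along which the image of
the boundary avoids the (moving) target. -/
theorem signedPreimageCount_eq_of_homotopy (hU : IsOpen U) (hb : Bornology.IsBounded U)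
    (hf : ContinuousOn f (closure U)) (hf' : ContDiffOn ℝ 1 f U)
    (hg : ContinuousOn g (closure U)) (hg' : ContDiffOn ℝ 1 g U) {z' : E3}
    (hz : IsRegularValueOn f U z) (hz' : IsRegularValueOn g U z')
    (h : ∀ s ∈ Icc (0 : ℝ) 1, ∀ x ∈ frontier U, (f x - z) + s • ((g x - z') - (f x - z)) ≠ 0) :
    signedPreimageCount f U z = signedPreimageCount g U z' := by
  obtain ⟨ε₁, hε₁, H₁⟩ := exists_integral_eq_signedPreimageCount hU hb hf hf' hz
  obtain ⟨ε₂, hε₂, H₂⟩ := exists_integral_eq_signedPreimageCount hU hb hg hg' hz'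
  have hfr : frontier U ⊆ closure U := frontier_subset_closure
  obtain ⟨ε₃, hε₃, H₃⟩ : ∃ ε > 0, ∀ s ∈ Icc (0 : ℝ) 1, ∀ x ∈ frontier U,
      (f x - z) + s • ((g x - z') - (f x - z)) ∉ ball 0 ε := by
    have hc : IsCompact (Icc (0 : ℝ) 1 ×ˢ frontier U) :=
      isCompact_Icc.prod (hb.isCompact_closure.of_isClosed_subset isClosed_frontier hfr)
    have hcont : ContinuousOn
        (fun p : ℝ × E3 => (f p.2 - z) + p.1 • ((g p.2 - z') - (f p.2 - z)))
        (Icc (0 : ℝ) 1 ×ˢ frontier U) := by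
      have c1 : ContinuousOn (fun p : ℝ × E3 => f p.2) (Icc (0 : ℝ) 1 ×ˢ frontier U) :=
        (hf.mono hfr).comp continuousOn_snd fun p hp => hp.2
      have c2 : ContinuousOn (fun p : ℝ × E3 => g p.2) (Icc (0 : ℝ) 1 ×ˢ frontier U) :=
        (hg.mono hfr).comp continuousOn_snd fun p hp => hp.2
      exact (c1.sub continuousOn_const).add (continuousOn_fst.smul
        ((c2.sub continuousOn_const).sub (c1.sub continuousOn_const)))
    have hcl := (hc.image_of_continuousOn hcont).isClosed.isOpen_compl
    obtain ⟨ε, hε, hb⟩ := Metric.isOpen_iff.1 hcl 0 (by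
      rintro ⟨⟨s, x⟩, ⟨hs, hx⟩, h0⟩
      exact h s hs x hx h0)
    exact ⟨ε, hε, fun s hs x hx hm => hb hm ⟨(s, x), ⟨hs, hx⟩, rfl⟩⟩
  set ε := min ε₁ (min ε₂ ε₃) with hεd
  have hε : 0 < ε := lt_min hε₁ (lt_min hε₂ hε₃)
  let φ : ContDiffBump (0 : E3) := ⟨ε / 4, ε / 2, by positivity, by linarith⟩
  have hφc : ContDiff ℝ 1 φ := φ.contDiff
  have hφs : ∀ w, Function.support (fun y => φ (y - w)) ⊆ ball w ε := fun w y hy => by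
    have : y - w ∈ Function.support φ := hy
    rw [φ.support_eq, mem_ball_zero_iff] at this
    rw [mem_ball_iff_norm]
    exact this.trans (half_lt_self hε)
  have hφt : tsupport φ ⊆ ball 0 ε := by
    rw [φ.tsupport_eq]
    exact closedBall_subset_ball (half_lt_self hε)
  have I₁ := H₁ (fun y => φ (y - z)) (by fun_prop)
    ((hφs z).trans (ball_subset_ball (min_le_left _ _)))
  have I₂ := H₂ (fun y => φ (y - z')) (by fun_prop)
    ((hφs z').trans (ball_subset_ball ((min_le_right _ _).trans (min_le_left _ _))))
  rw [integral_sub_right_eq_self (fun y => φ y)] at I₁ I₂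
  -- Subtracting the targets moves both to the origin, so that a single bump there serves for both
  -- maps and for all intermediate stages.
  have I₃ := integral_degree_homotopy (f := fun x => f x - z)
    (u := fun x => (g x - z') - (f x - z)) hU hb (hf.sub continuousOn_const)
    (hf'.sub contDiffOn_const) ((hg.sub continuousOn_const).sub (hf.sub continuousOn_const))
    ((hg'.sub contDiffOn_const).sub (hf'.sub contDiffOn_const)) hφc (fun s hs x hx hm =>
      H₃ s hs x hx (ball_subset_ball ((min_le_right _ _).trans (min_le_right _ _)) (hφt hm)))
  have e1 : ∫ x in U, φ (f x - z) * (fderiv ℝ (fun x => f x - z) x).det =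
      ∫ x in U, φ (f x - z) * (fderiv ℝ f x).det := by simp only [fderiv_sub_const]
  have e2 : ∫ x in U, φ (f x - z + (g x - z' - (f x - z))) * (fderiv ℝ (fun x => f x - z) x +
      fderiv ℝ (fun x => (g x - z') - (f x - z)) x).det =
      ∫ x in U, φ (g x - z') * (fderiv ℝ g x).det := by
    refine setIntegral_congr_fun hU.measurableSet fun x hx => ?_
    have df := (hf'.contDiffAt (hU.mem_nhds hx)).differentiableAt one_ne_zero
    have dg := (hg'.contDiffAt (hU.mem_nhds hx)).differentiableAt one_ne_zero
    beta_reduce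
    rw [fderiv_fun_sub (dg.sub_const _) (df.sub_const _), fderiv_sub_const, fderiv_sub_const,
      add_sub_cancel, add_sub_cancel]
  rw [e1, e2, I₁, I₂] at I₃
  exact_mod_cast (mul_right_cancel₀ φ.integral_pos.ne' I₃).symm

/-- Sard's lemma in equal dimensions. -/
theorem volume_criticalValues_eq_zero (μ : Measure E3) [μ.IsAddHaarMeasure] {V : Set E3}
    (hf : ∀ x ∈ V, DifferentiableAt ℝ f x) :
    μ {z | ∃ x ∈ V, f x = z ∧ (fderiv ℝ f x).det = 0} = 0 := by
  have h := addHaar_image_eq_zero_of_det_fderivWithin_eq_zero μ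
    (s := {x | x ∈ V ∧ (fderiv ℝ f x).det = 0}) (f := f) (f' := fderiv ℝ f)
    (fun x hx => (hf x hx.1).hasFDerivAt.hasFDerivWithinAt) (fun x hx => hx.2)
  convert h using 2
  ext z
  simp only [mem_ofPred_eq, mem_image]
  exact ⟨fun ⟨x, h1, h2, h3⟩ => ⟨x, ⟨h1, h3⟩, h2⟩, fun ⟨x, ⟨h1, h3⟩, h2⟩ => ⟨x, h1, h2, h3⟩⟩

theorem exists_mem_of_null (μ : Measure E3) [μ.IsAddHaarMeasure] {N O : Set E3} (hN : μ N = 0)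
    (hO : IsOpen O) (hne : O.Nonempty) : ∃ z ∈ O, z ∉ N := by
  by_contra! h
  exact (hO.measure_pos μ hne).ne' (measure_mono_null h hN)

theorem isOpen_compl_image_frontier (hb : Bornology.IsBounded U)
    (hf : ContinuousOn f (closure U)) : IsOpen (f '' frontier U)ᶜ :=
  ((hb.isCompact_closure.of_isClosed_subset isClosed_frontier
    frontier_subset_closure).image_of_continuousOn
    (hf.mono frontier_subset_closure)).isClosed.isOpen_compl

/-- The critical values of both maps together form a null set. Having one value regular for two maps
is what the comparison of fillings needs. -/
theorem exists_regularValue (hU : IsOpen U) (hf' : ContDiffOn ℝ 1 f U)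
    (hg' : ContDiffOn ℝ 1 g U) {O : Set E3} (hO : IsOpen O) (hne : O.Nonempty)
    (hOf : O ⊆ (f '' frontier U)ᶜ) (hOg : O ⊆ (g '' frontier U)ᶜ) :
    ∃ z ∈ O, IsRegularValueOn f U z ∧ IsRegularValueOn g U z := by
  have hd : ∀ {k : E3 → E3}, ContDiffOn ℝ 1 k U → ∀ x ∈ U, DifferentiableAt ℝ k x :=
    fun hk x hx => (hk.contDiffAt (hU.mem_nhds hx)).differentiableAt one_ne_zero
  obtain ⟨z, hz, hzN⟩ := exists_mem_of_null volume
    (measure_union_null (volume_criticalValues_eq_zero volume (hd hf'))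
      (volume_criticalValues_eq_zero volume (hd hg'))) hO hne
  simp only [mem_union, mem_ofPred_eq, not_or, not_exists, not_and] at hzN
  exact ⟨z, hz, ⟨hOf hz, hzN.1⟩, ⟨hOg hz, hzN.2⟩⟩

/-- A ball is convex, so the segment between two regular values in it avoids the image of the
boundary, and sliding the target along it is an admissible homotopy. -/
theorem hasBrouwerDegree_of_ball (hU : IsOpen U) (hb : Bornology.IsBounded U)
    (hf : ContinuousOn f (closure U)) (hf' : ContDiffOn ℝ 1 f U) {y y' : E3} {r : ℝ}
    (hr : ball y r ⊆ (f '' frontier U)ᶜ) (hz : IsRegularValueOn f U z) (hzr : z ∈ ball y r)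
    (hy' : y' ∈ ball y r) : HasBrouwerDegree f U y' (signedPreimageCount f U z) := by
  refine ⟨hr hy', ?_, ?_⟩
  · rw [frequently_nhds_iff]
    intro O hyO hO
    obtain ⟨w, hw, hw', -⟩ := exists_regularValue hU hf' hf' (hO.inter isOpen_ball) ⟨y', hyO, hy'⟩
      (inter_subset_right.trans hr) (inter_subset_right.trans hr)
    exact ⟨w, hw.1, hw'⟩
  · filter_upwards [isOpen_ball.mem_nhds hy'] with w hw hwr
    refine signedPreimageCount_eq_of_homotopy hU hb hf hf' hf hf' hwr hz fun s hs x hx h0 => ?_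
    have hseg : w + s • (z - w) ∈ ball y r :=
      (convex_ball y r).add_smul_sub_mem hw hzr hs
    refine hr hseg ⟨x, hx, ?_⟩
    rw [← sub_eq_zero, ← h0]
    simp only [smul_sub]; abel

/-- The Brouwer degree exists. -/
theorem exists_hasBrouwerDegree (hU : IsOpen U) (hb : Bornology.IsBounded U)
    (hf : ContinuousOn f (closure U)) (hf' : ContDiffOn ℝ 1 f U) {y : E3}
    (hy : y ∉ f '' frontier U) :
    ∃ n, ∀ᶠ y' in 𝓝 y, HasBrouwerDegree f U y' n := by
  obtain ⟨r, hr, hball⟩ := Metric.isOpen_iff.1 (isOpen_compl_image_frontier hb hf) y hy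
  obtain ⟨z, hz, hz', -⟩ := exists_regularValue hU hf' hf' isOpen_ball ⟨y, mem_ball_self hr⟩
    hball hball
  exact ⟨_, (eventually_mem_nhds_iff.2 (ball_mem_nhds y hr)).mono fun y' hy' =>
    hasBrouwerDegree_of_ball hU hb hf hf' hball hz' hz (mem_of_mem_nhds hy')⟩

/-- The Brouwer degree is constant on connected sets that avoid the image of the boundary. -/
theorem hasBrouwerDegree_of_isPreconnected (hU : IsOpen U) (hb : Bornology.IsBounded U)
    (hf : ContinuousOn f (closure U)) (hf' : ContDiffOn ℝ 1 f U) {A : Set E3}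
    (hA : IsPreconnected A) (hAf : A ⊆ (f '' frontier U)ᶜ) {y y' : E3} (hy : y ∈ A) (hy' : y' ∈ A)
    {n : ℤ} (hn : HasBrouwerDegree f U y n) : HasBrouwerDegree f U y' n := by
  classical
  -- The default 0 is never used on `A`, where the degree exists and is locally constant; hence `D`
  -- is continuous on `A` with values in `ℤ`.
  let D : E3 → ℤ := fun x => if h : ∃ n, HasBrouwerDegree f U x n then h.choose else 0
  have hD : ∀ {x n}, HasBrouwerDegree f U x n → D x = n := fun {x n} h => by
    have hex : ∃ n, HasBrouwerDegree f U x n := ⟨n, h⟩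
    simp only [D, dif_pos hex]
    exact hex.choose_spec.unique h
  have hcont : ContinuousOn D A := fun x hx => by
    obtain ⟨m, hm⟩ := exists_hasBrouwerDegree hU hb hf hf' (hAf hx)
    refine ContinuousAt.continuousWithinAt ?_
    refine (continuousAt_const (y := m)).congr ?_
    filter_upwards [hm] with w hw using (hD hw).symm
  obtain ⟨m, hm⟩ := exists_hasBrouwerDegree hU hb hf hf' (hAf hy')
  have hm' := hm.self_of_nhds
  have := hA.constant hcont hy hy'
  rw [hD hn, hD hm'] at this
  rwa [this]

/-- The Brouwer degree depends only on the values on the boundary. -/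
theorem hasBrouwerDegree_congr_frontier (hU : IsOpen U) (hb : Bornology.IsBounded U)
    (hf : ContinuousOn f (closure U)) (hf' : ContDiffOn ℝ 1 f U)
    (hg : ContinuousOn g (closure U)) (hg' : ContDiffOn ℝ 1 g U) (hfg : EqOn f g (frontier U))
    {y : E3} {n : ℤ} (hn : HasBrouwerDegree f U y n) : HasBrouwerDegree g U y n := by
  have him : f '' frontier U = g '' frontier U := image_congr hfg
  obtain ⟨r, hr, hball⟩ := Metric.isOpen_iff.1 (isOpen_compl_image_frontier hb hf) y hn.1
  have hball' : ball y r ⊆ (g '' frontier U)ᶜ := him ▸ hball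
  obtain ⟨z, hz, hzf, hzg⟩ := exists_regularValue hU hf' hg' isOpen_ball ⟨y, mem_ball_self hr⟩
    hball hball'
  have h1 := hasBrouwerDegree_of_ball hU hb hf hf' hball hzf hz (mem_ball_self hr)
  have h2 := hasBrouwerDegree_of_ball hU hb hg hg' hball' hzg hz (mem_ball_self hr)
  rw [hn.unique h1]
  rwa [signedPreimageCount_eq_of_homotopy hU hb hf hf' hg hg' hzf hzg fun s hs x hx h0 => ?_]
  rw [hfg hx] at h0
  simp only [sub_self, smul_zero, add_zero] at h0
  exact hzg.1 ⟨x, hx, sub_eq_zero.1 h0⟩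

end

open Module

/-! ### The radial extension of a map of the sphere -/

theorem norm_coe (p : S2) : ‖(p : E3)‖ = 1 := norm_eq_of_mem_sphere p

theorem coe_ne_zero (p : S2) : (p : E3) ≠ 0 := ne_zero_of_mem_unit_sphere p

theorem inner_coe_self (p : S2) : inner ℝ (p : E3) p = 1 := by
  rw [real_inner_self_eq_norm_sq, norm_coe]; norm_num

open Classical in
/-- The radial projection to the unit sphere (with a junk value at the origin). -/
noncomputable def toSphere (x : E3) : S2 :=
  if h : x ≠ 0 then ⟨‖x‖⁻¹ • x, by
    rw [mem_sphere_zero_iff_norm, norm_smul, norm_inv, norm_norm,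
      inv_mul_cancel₀ (norm_ne_zero_iff.2 h)]⟩
  else ⟨EuclideanSpace.single 0 1, by simp⟩

theorem coe_toSphere {x : E3} (h : x ≠ 0) : (toSphere x : E3) = ‖x‖⁻¹ • x := by
  rw [toSphere, dif_pos h]

theorem norm_smul_toSphere {x : E3} (h : x ≠ 0) : ‖x‖ • (toSphere x : E3) = x := by
  rw [coe_toSphere h, smul_smul, mul_inv_cancel₀ (norm_ne_zero_iff.2 h), one_smul]

theorem toSphere_smul {r : ℝ} (hr : 0 < r) (p : S2) : toSphere (r • (p : E3)) = p := by
  ext1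
  rw [coe_toSphere (smul_ne_zero hr.ne' (coe_ne_zero p)), norm_smul, norm_coe, mul_one,
    Real.norm_of_nonneg hr.le, smul_smul, inv_mul_cancel₀ hr.ne', one_smul]

theorem toSphere_coe (p : S2) : toSphere (p : E3) = p := by
  simpa using toSphere_smul one_pos p

/-- The extension of a map of the sphere that is constant on rays. -/
noncomputable def radialExt (ι : S2 → E3) (x : E3) : E3 := ι (toSphere x)

theorem radialExt_smul (ι : S2 → E3) {r : ℝ} (hr : 0 < r) (p : S2) :
    radialExt ι (r • (p : E3)) = ι p := by rw [radialExt, toSphere_smul hr]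

theorem radialExt_coe (ι : S2 → E3) (p : S2) : radialExt ι p = ι p := by
  rw [radialExt, toSphere_coe]

theorem radialExt_smul' (ι : S2 → E3) {r : ℝ} (hr : 0 < r) (x : E3) :
    radialExt ι (r • x) = radialExt ι x := by
  by_cases hx : x = 0
  · rw [hx, smul_zero]
  · have hx' : 0 < ‖x‖ := norm_pos_iff.2 hx
    rw [← norm_smul_toSphere hx, smul_smul, radialExt_smul ι (mul_pos hr hx'), radialExt_smul ι hx']

theorem contDiffAt_radialExt {ι : S2 → E3} (hι : ContMDiff (𝓡 2) 𝓘(ℝ, E3) ∞ ι) {x : E3}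
    (hx : x ≠ 0) : ContDiffAt ℝ ∞ (radialExt ι) x := by
  -- The formula `‖y‖⁻¹ • y` lands in the sphere only away from the origin, so the restriction of
  -- the codomain is made on the punctured space as an open submanifold.
  let O : TopologicalSpace.Opens E3 := ⟨{0}ᶜ, isOpen_compl_singleton⟩
  have hn : ContMDiff 𝓘(ℝ, E3) 𝓘(ℝ, E3) ∞ (fun y : O => (fun y : E3 => ‖y‖⁻¹ • y) y) := fun y => by
    have hy : (y : E3) ≠ 0 := y.2
    refine (contMDiffAt_subtype_iff (f := fun y : E3 => ‖y‖⁻¹ • y)).2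
      (contMDiffAt_iff_contDiffAt.2 ?_)
    exact ((contDiffAt_norm ℝ hy).inv (norm_ne_zero_iff.2 hy)).smul contDiffAt_id
  have : Fact (finrank ℝ E3 = 2 + 1) := ⟨finrank_euclideanSpace_fin⟩
  have hs : ∀ y : O, (fun y : E3 => ‖y‖⁻¹ • y) y ∈ sphere (0 : E3) 1 := fun y => by
    have hy : (y : E3) ≠ 0 := y.2
    have h := (toSphere (y : E3)).2
    rw [coe_toSphere hy] at h
    exact h
  have hc := hι.comp (hn.codRestrict_sphere hs)
  have h := hc.contMDiffAt (x := (⟨x, hx⟩ : O))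
  have he : (ι ∘ codRestrict (fun y : O => (fun y : E3 => ‖y‖⁻¹ • y) y) _ hs) =
      fun y : O => radialExt ι y := by
    funext y
    have hy : (y : E3) ≠ 0 := y.2
    simp only [Function.comp_apply, radialExt]
    congr 1
    ext1
    rw [coe_toSphere hy]; rfl
  rw [he, contMDiffAt_subtype_iff, contMDiffAt_iff_contDiffAt] at h
  exact h

theorem differentiableAt_radialExt {ι : S2 → E3} (hι : ContMDiff (𝓡 2) 𝓘(ℝ, E3) ∞ ι) {x : E3}
    (hx : x ≠ 0) : DifferentiableAt ℝ (radialExt ι) x :=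
  (contDiffAt_radialExt hι hx).differentiableAt (by simp)

/-- The chain rule for `ι` as the radial extension composed with the inclusion. It turns manifold
differentials into Fréchet derivatives on `ℝ³`. -/
theorem sphereDiff_eq {ι : S2 → E3} (hι : ContMDiff (𝓡 2) 𝓘(ℝ, E3) ∞ ι) (p : S2)
    (v : TangentSpace (𝓡 2) p) :
    sphereDiff ι p v = fderiv ℝ (radialExt ι) p (sphereDiff (fun q : S2 => (q : E3)) p v) := by
  have : Fact (finrank ℝ E3 = 2 + 1) := ⟨finrank_euclideanSpace_fin⟩
  have h1 : MDifferentiableAt 𝓘(ℝ, E3) 𝓘(ℝ, E3) (radialExt ι) (p : E3) :=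
    (differentiableAt_radialExt hι (coe_ne_zero p)).mdifferentiableAt
  have h2 : MDifferentiableAt (𝓡 2) 𝓘(ℝ, E3) (fun q : S2 => (q : E3)) p :=
    (contMDiff_coe_sphere (m := 1) p).mdifferentiableAt one_ne_zero
  have h3 := mfderiv_comp_apply p h1 h2 v
  have h4 : radialExt ι ∘ (fun q : S2 => (q : E3)) = ι := by
    funext q; exact radialExt_coe ι q
  rw [h4, mfderiv_eq_fderiv] at h3
  exact h3

theorem range_sphereDiff_coe (p : S2) :
    (sphereDiff (fun q : S2 => (q : E3)) p).range = (ℝ ∙ (p : E3))ᗮ := by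
  have : Fact (finrank ℝ E3 = 2 + 1) := ⟨finrank_euclideanSpace_fin⟩
  exact range_mvfderiv_subtypeVal p

theorem injective_sphereDiff_coe (p : S2) :
    Function.Injective (sphereDiff (fun q : S2 => (q : E3)) p) := by
  have : Fact (finrank ℝ E3 = 2 + 1) := ⟨finrank_euclideanSpace_fin⟩
  exact injective_mvfderiv_subtypeVal_sphere p

theorem inner_sphereDiff_coe (p : S2) (v : TangentSpace (𝓡 2) p) :
    inner ℝ (p : E3) (sphereDiff (fun q : S2 => (q : E3)) p v) = 0 := by
  have : sphereDiff (fun q : S2 => (q : E3)) p v ∈ (sphereDiff (fun q : S2 => (q : E3)) p).range :=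
    ⟨v, rfl⟩
  rw [range_sphereDiff_coe] at this
  exact Submodule.mem_orthogonal_singleton_iff_inner_right.1 this

theorem exists_sphereDiff_coe_eq (p : S2) {ξ : E3} (h : inner ℝ (p : E3) ξ = 0) :
    ∃ v, sphereDiff (fun q : S2 => (q : E3)) p v = ξ := by
  have : ξ ∈ (sphereDiff (fun q : S2 => (q : E3)) p).range := by
    rw [range_sphereDiff_coe]
    exact Submodule.mem_orthogonal_singleton_iff_inner_right.2 h
  exact this

/-- A function homogeneous of degree 0 has a derivative homogeneous of degree -1. -/
theorem fderiv_radialExt_smul {ι : S2 → E3} (hι : ContMDiff (𝓡 2) 𝓘(ℝ, E3) ∞ ι) {r : ℝ}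
    (hr : 0 < r) (p : S2) (ξ : E3) :
    fderiv ℝ (radialExt ι) (r • (p : E3)) ξ = r⁻¹ • fderiv ℝ (radialExt ι) p ξ := by
  have h1 : HasFDerivAt (fun x : E3 => r⁻¹ • x) (r⁻¹ • ContinuousLinearMap.id ℝ E3)
      (r • (p : E3)) := (hasFDerivAt_id _).fun_const_smul _
  have h0 : r⁻¹ • r • (p : E3) = p := by rw [smul_smul, inv_mul_cancel₀ hr.ne', one_smul]
  have h2 : HasFDerivAt (radialExt ι) (fderiv ℝ (radialExt ι) p) (r⁻¹ • r • (p : E3)) := by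
    rw [h0]; exact (differentiableAt_radialExt hι (coe_ne_zero p)).hasFDerivAt
  have h3 := h2.comp _ h1
  have h4 : radialExt ι ∘ (fun x : E3 => r⁻¹ • x) = radialExt ι := by
    funext x; exact radialExt_smul' ι (inv_pos.2 hr) x
  rw [h4] at h3
  rw [h3.fderiv]; simp

theorem fderiv_radialExt_self {ι : S2 → E3} (hι : ContMDiff (𝓡 2) 𝓘(ℝ, E3) ∞ ι) (p : S2) :
    fderiv ℝ (radialExt ι) p p = 0 := by
  have h1 : HasDerivAt (fun t : ℝ => t • (p : E3)) (p : E3) 1 := by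
    simpa using (hasDerivAt_id (1 : ℝ)).smul_const (p : E3)
  have h2 : HasFDerivAt (radialExt ι) (fderiv ℝ (radialExt ι) p) ((1 : ℝ) • (p : E3)) := by
    rw [one_smul]; exact (differentiableAt_radialExt hι (coe_ne_zero p)).hasFDerivAt
  have h3 := h2.comp_hasDerivAt 1 h1
  have h4 : (radialExt ι ∘ fun t : ℝ => t • (p : E3)) =ᶠ[𝓝 1] fun _ => ι p := by
    filter_upwards [lt_mem_nhds (zero_lt_one' ℝ)] with t ht using radialExt_smul ι ht p
  exact (h3.congr_of_eventuallyEq h4.symm).unique (hasDerivAt_const _ _)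

/-! ### The sign of a crossing -/

theorem inner_cross3_map (M : E3 →L[ℝ] E3) (x y z : E3) :
    inner ℝ (M x) (cross3 (M y) (M z)) = M.det * inner ℝ x (cross3 y z) := by
  have hM : ∀ x i, M x i = ∑ j, x j * row M i j := fun x i => by
    have := clm_apply_eq_sum ((coord i).comp M) x
    simpa [row] using this
  have hi : ∀ x y z : E3, inner ℝ x (cross3 y z) =
      x 0 * (y 1 * z 2 - y 2 * z 1) + x 1 * (y 2 * z 0 - y 0 * z 2) +
        x 2 * (y 0 * z 1 - y 1 * z 0) := fun x y z => by
    simp only [cross3, crossProduct, PiLp.inner_apply, Fin.sum_univ_three]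
    simp
    ring
  rw [hi, hi, det_eq_det3]
  simp only [hM, Fin.sum_univ_three, det3]
  ring

/-- This is the volume spanned by `p` and two independent vectors orthogonal to it. Only
nonvanishing is needed: `orientedNormal` carries this number as a factor, so its sign cancels in
`sign_det_eq`. -/
theorem inner_coe_cross3_ne_zero (p : S2) :
    inner ℝ (p : E3) (cross3 (sphereDiff (fun q : S2 => (q : E3)) p (tangentBasis p 0))
        (sphereDiff (fun q : S2 => (q : E3)) p (tangentBasis p 1))) ≠ 0 := by
  set a := sphereDiff (fun q : S2 => (q : E3)) p (tangentBasis p 0) with ha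
  set b := sphereDiff (fun q : S2 => (q : E3)) p (tangentBasis p 1) with hb
  let M : E3 →L[ℝ] E3 := (coord 0).smulRight (p : E3) + (coord 1).smulRight a +
    (coord 2).smulRight b
  have hMx : ∀ x, M x = x 0 • (p : E3) + x 1 • a + x 2 • b := fun x => rfl
  have hM := inner_cross3_map M (EuclideanSpace.single 0 1) (EuclideanSpace.single 1 1)
    (EuclideanSpace.single 2 1)
  have e1 : inner ℝ (EuclideanSpace.single 0 1 : E3) (cross3 (EuclideanSpace.single 1 1)
      (EuclideanSpace.single 2 1)) = 1 := by
    simp [cross3, crossProduct, EuclideanSpace.inner_single_left]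
  have e2 : M (EuclideanSpace.single 0 1) = p ∧ M (EuclideanSpace.single 1 1) = a ∧
      M (EuclideanSpace.single 2 1) = b := by simp [hMx]
  rw [e1, e2.1, e2.2.1, e2.2.2, mul_one] at hM
  rw [hM]
  intro hdet
  obtain ⟨x, hx, hx0⟩ := (Submodule.ne_bot_iff _).1
    (LinearMap.bot_lt_ker_of_det_eq_zero (f := (M : E3 →ₗ[ℝ] E3)) hdet).ne'
  have hx' : x 0 • (p : E3) + x 1 • a + x 2 • b = 0 := hx
  have h0 : x 0 = 0 := by
    have := congrArg (inner ℝ (p : E3)) hx'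
    simpa [inner_add_right, inner_smul_right, ha, hb, inner_sphereDiff_coe, norm_coe] using this
  rw [h0, zero_smul, zero_add, ha, hb, ← map_smul, ← map_smul, ← map_add] at hx'
  have h1 : x 1 • tangentBasis p 0 + x 2 • tangentBasis p 1 = 0 :=
    injective_sphereDiff_coe p (hx'.trans (map_zero _).symm)
  have h2 : x 1 • (EuclideanSpace.single 0 1 : EuclideanSpace ℝ (Fin 2)) +
      x 2 • (EuclideanSpace.single 1 1 : EuclideanSpace ℝ (Fin 2)) = 0 := by
    rw [← EuclideanSpace.basisFun_apply, ← EuclideanSpace.basisFun_apply]; exact h1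
  have h3 : x 1 = 0 := by simpa using congrArg (fun w : EuclideanSpace ℝ (Fin 2) => w 0) h2
  have h4 : x 2 = 0 := by simpa using congrArg (fun w : EuclideanSpace ℝ (Fin 2) => w 1) h2
  exact hx0 (by ext i; fin_cases i <;> simp [h0, h3, h4])

/-- The crossing sign as the sign of a determinant. -/
theorem sign_det_eq {ι : S2 → E3} (hι : ContMDiff (𝓡 2) 𝓘(ℝ, E3) ∞ ι) (p : S2)
    {M : E3 →L[ℝ] E3} {v : E3} {k : ℝ} (hk : 0 < k) (hp : M p = v)
    (hM : ∀ ξ, inner ℝ (p : E3) ξ = 0 → M ξ = k • fderiv ℝ (radialExt ι) p ξ) :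
    SignType.sign M.det = SignType.sign (inner ℝ v (orientedNormal ι p)) := by
  have h := inner_cross3_map M p (sphereDiff (fun q : S2 => (q : E3)) p (tangentBasis p 0))
    (sphereDiff (fun q : S2 => (q : E3)) p (tangentBasis p 1))
  have ht := inner_coe_cross3_ne_zero p
  rw [hp, hM _ (inner_sphereDiff_coe p _), hM _ (inner_sphereDiff_coe p _)] at h
  rw [orientedNormal, inner_smul_right, sphereDiff_eq hι, sphereDiff_eq hι]
  set a := sphereDiff (fun q : S2 => (q : E3)) p (tangentBasis p 0)
  set b := sphereDiff (fun q : S2 => (q : E3)) p (tangentBasis p 1)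
  set t := inner ℝ (p : E3) (cross3 a b)
  have hc : ∀ x y : E3, cross3 (k • x) (k • y) = (k * k) • cross3 x y := fun x y => by
    ext i
    fin_cases i <;> simp [cross3, crossProduct] <;> ring
  rw [hc, inner_smul_right] at h
  set s := inner ℝ v (cross3 (fderiv ℝ (radialExt ι) p a) (fderiv ℝ (radialExt ι) p b))
  -- The orientation factor `t` enters once through the normal and once through the triple product,
  -- so it appears squared.
  have hs : t * s = (t * t / (k * k)) * M.det := by
    field_simp
    linear_combination h
  have hpos : 0 < t * t / (k * k) := div_pos (mul_self_pos.2 ht) (mul_pos hk hk)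
  rw [hs, sign_mul, sign_pos hpos, one_mul]

/-- The endomorphism that agrees with the differential of the sheet on the tangent plane and sends
the position vector to `v`. -/
noncomputable def sheetMap (ι : S2 → E3) (p : S2) (v : E3) : E3 →L[ℝ] E3 :=
  fderiv ℝ (radialExt ι) p + (innerSL ℝ (p : E3)).smulRight v

theorem sheetMap_self {ι : S2 → E3} (hι : ContMDiff (𝓡 2) 𝓘(ℝ, E3) ∞ ι)
    (p : S2) (v : E3) : sheetMap ι p v p = v := by
  simp [sheetMap, fderiv_radialExt_self hι]

theorem sheetMap_of_inner_eq_zero {ι : S2 → E3} (p : S2) (v : E3) {ξ : E3}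
    (h : inner ℝ (p : E3) ξ = 0) :
    sheetMap ι p v ξ = fderiv ℝ (radialExt ι) p ξ := by
  simp [sheetMap, h]

theorem sign_det_sheetMap {ι : S2 → E3} (hι : ContMDiff (𝓡 2) 𝓘(ℝ, E3) ∞ ι)
    (p : S2) (v : E3) :
    SignType.sign (sheetMap ι p v).det = SignType.sign (inner ℝ v (orientedNormal ι p)) :=
  sign_det_eq hι p one_pos (sheetMap_self hι p v) fun ξ h => by
    rw [sheetMap_of_inner_eq_zero p v h, one_smul]

theorem det_sheetMap_eq_zero_iff {ι : S2 → E3} (hι : ContMDiff (𝓡 2) 𝓘(ℝ, E3) ∞ ι)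
    (p : S2) (v : E3) :
    (sheetMap ι p v).det = 0 ↔ inner ℝ v (orientedNormal ι p) = 0 := by
  rw [← sign_eq_zero_iff, sign_det_sheetMap hι, sign_eq_zero_iff]

theorem range_sphereDiff {ι : S2 → E3} (hι : ContMDiff (𝓡 2) 𝓘(ℝ, E3) ∞ ι)
    (p : S2) :
    (sphereDiff ι p).range = (fderiv ℝ (radialExt ι) p).range := by
  ext x
  simp only [LinearMap.mem_range]
  constructor
  · rintro ⟨v, rfl⟩
    exact ⟨sphereDiff (fun q : S2 => (q : E3)) p v, (sphereDiff_eq hι p v).symm⟩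
  · rintro ⟨ξ, rfl⟩
    obtain ⟨v, hv⟩ := exists_sphereDiff_coe_eq p (ξ := ξ - inner ℝ (p : E3) ξ • (p : E3)) (by
      rw [inner_sub_right, inner_smul_right, inner_coe_self, mul_one, sub_self])
    refine ⟨v, (sphereDiff_eq hι p v).trans ?_⟩
    rw [hv, map_sub, map_smul,
      fderiv_radialExt_self hι, smul_zero, sub_zero]
    rfl

/-- If `v` is tangent to the sheet, `sheetMap ι p v` sends both `p` and some vector orthogonal to
`p` to `v`; it is not injective and its determinant vanishes. -/
theorem inner_fderiv_radialExt_orientedNormal {ι : S2 → E3} (hι : ContMDiff (𝓡 2) 𝓘(ℝ, E3) ∞ ι)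
    (p : S2) (ξ : E3) :
    inner ℝ (fderiv ℝ (radialExt ι) p ξ) (orientedNormal ι p) = 0 := by
  rw [← det_sheetMap_eq_zero_iff hι]
  by_contra hdet
  set L := (sheetMap ι p (fderiv ℝ (radialExt ι) p ξ)).toContinuousLinearEquivOfDetNeZero hdet
  have h0 : inner ℝ (p : E3) (ξ - inner ℝ (p : E3) ξ • (p : E3)) = 0 := by
    rw [inner_sub_right, inner_smul_right, inner_coe_self, mul_one, sub_self]
  have h1 : L p = L (ξ - inner ℝ (p : E3) ξ • (p : E3)) := by
    simp only [L, ContinuousLinearMap.toContinuousLinearEquivOfDetNeZero_apply]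
    rw [sheetMap_self hι, sheetMap_of_inner_eq_zero p _ h0, map_sub, map_smul,
      fderiv_radialExt_self hι, smul_zero, sub_zero]
  have h2 := L.injective h1
  rw [← h2, inner_coe_self] at h0
  exact one_ne_zero h0

/-- A direction is transverse to a sheet iff it is not orthogonal to the normal. -/
theorem span_sup_range_eq_top_iff {ι : S2 → E3} (hι : ContMDiff (𝓡 2) 𝓘(ℝ, E3) ∞ ι)
    (p : S2) (v : E3) :
    Submodule.span ℝ {v} ⊔ (sphereDiff ι p).range = ⊤ ↔
      inner ℝ v (orientedNormal ι p) ≠ 0 := by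
  rw [range_sphereDiff hι, Ne, ← det_sheetMap_eq_zero_iff hι]
  have hsplit : ∀ ξ, sheetMap ι p v ξ = fderiv ℝ (radialExt ι) p ξ + inner ℝ (p : E3) ξ • v :=
    fun ξ => by simp [sheetMap]
  constructor
  · intro htop hdet
    refine (LinearMap.range_lt_top_of_det_eq_zero (f := (sheetMap ι p v : E3 →ₗ[ℝ] E3)) hdet).ne ?_
    rw [eq_top_iff, ← htop, sup_le_iff, Submodule.span_singleton_le_iff_mem]
    refine ⟨⟨p, sheetMap_self hι p v⟩, ?_⟩
    rintro _ ⟨ξ, rfl⟩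
    refine ⟨ξ - inner ℝ (p : E3) ξ • (p : E3), ?_⟩
    have h := hsplit (ξ - inner ℝ (p : E3) ξ • (p : E3))
    rw [inner_sub_right, inner_smul_right, inner_coe_self, mul_one, sub_self, zero_smul, add_zero,
      (fderiv ℝ (radialExt ι) p).map_sub, (fderiv ℝ (radialExt ι) p).map_smul,
      fderiv_radialExt_self hι, smul_zero,
      sub_zero] at h
    exact h
  · intro hdet
    rw [eq_top_iff]
    intro x _
    obtain ⟨ξ, hξ⟩ := ((sheetMap ι p v).toContinuousLinearEquivOfDetNeZero hdet).surjective x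
    rw [ContinuousLinearMap.toContinuousLinearEquivOfDetNeZero_apply, hsplit] at hξ
    rw [← hξ, add_comm]
    exact Submodule.add_mem_sup (Submodule.smul_mem _ _ (Submodule.mem_span_singleton_self v))
      ⟨ξ, rfl⟩

/-! ### Maps of the form `α(|x|) J(x) + β(|x|)` -/

theorem hasFDerivAt_norm {x : E3} (hx : x ≠ 0) :
    HasFDerivAt (fun y : E3 => ‖y‖) (‖x‖⁻¹ • innerSL ℝ x) x := by
  have h := (hasStrictFDerivAt_norm_sq x).hasFDerivAt.sqrt (by simpa using hx)
  have hx' : ‖x‖ ≠ 0 := norm_ne_zero_iff.2 hx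
  simp only [Real.sqrt_sq (norm_nonneg _)] at h
  refine h.congr_fderiv ?_
  ext ξ
  simp
  field_simp

/-- Radially the derivative is `α' • ι p + β'`; on vectors orthogonal to `p` it is a positive
multiple of the differential of the sheet. This one computation yields the signs for the cone and
the genericity of rays and of quadratic paths. -/
theorem sign_det_fderiv_radial {ι : S2 → E3} (hι : ContMDiff (𝓡 2) 𝓘(ℝ, E3) ∞ ι) (p : S2)
    {r : ℝ} (hr : 0 < r) {α : ℝ → ℝ} {β : ℝ → E3} {α' : ℝ} {β' : E3} (hα : HasDerivAt α α' r)
    (hβ : HasDerivAt β β' r) (hpos : 0 < α r) :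
    SignType.sign (fderiv ℝ (fun x => α ‖x‖ • radialExt ι x + β ‖x‖) (r • (p : E3))).det =
      SignType.sign (inner ℝ (α' • ι p + β') (orientedNormal ι p)) := by
  have hx : r • (p : E3) ≠ 0 := smul_ne_zero hr.ne' (coe_ne_zero p)
  have hnorm : ‖r • (p : E3)‖ = r := by
    rw [norm_smul, norm_coe, mul_one, Real.norm_of_nonneg hr.le]
  have hn := hasFDerivAt_norm hx
  have h1 : HasFDerivAt (fun x : E3 => α ‖x‖) _ (r • (p : E3)) :=
    HasDerivAt.comp_hasFDerivAt _ (by rwa [hnorm]) hn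
  have h2 : HasFDerivAt (fun x : E3 => β ‖x‖) _ (r • (p : E3)) :=
    HasFDerivAt.comp _ (by rw [hnorm]; exact hβ.hasFDerivAt) hn
  have h3 := (h1.smul (differentiableAt_radialExt hι hx).hasFDerivAt).add h2
  have h4 : fderiv ℝ (fun x => α ‖x‖ • radialExt ι x + β ‖x‖) (r • (p : E3)) = _ := h3.fderiv
  rw [h4]
  refine sign_det_eq hι p (k := α r / r) (div_pos hpos hr) ?_ fun ξ hξ => ?_
  · simp [fderiv_radialExt_smul hι hr, fderiv_radialExt_self hι, radialExt_smul ι hr, norm_smul,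
      abs_of_pos hr, hr.ne']
  · simp [fderiv_radialExt_smul hι hr, radialExt_smul ι hr, norm_smul, abs_of_pos hr, hr.ne', hξ,
      smul_smul, div_eq_mul_inv]


/-! ### The immersed sphere near a simple point -/

/-- The normal component of the increment is `o(‖p' - p‖)`, and when the normal is nonzero `‖p' -
p‖` is controlled by `‖ι p' - ι p‖`. -/
theorem eventually_inner_le {ι : S2 → E3} (hι : ContMDiff (𝓡 2) 𝓘(ℝ, E3) ∞ ι) (p : S2) {η : ℝ}
    (hη : 0 < η) :
    ∀ᶠ p' in 𝓝 p, |inner ℝ (ι p' - ι p) (orientedNormal ι p)| ≤ η * ‖ι p' - ι p‖ := by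
  set N := orientedNormal ι p with hN
  by_cases hN0 : N = 0
  · simp only [hN0, inner_zero_right, abs_zero]
    exact .of_forall fun _ => by positivity
  have hJ : HasFDerivAt (radialExt ι) (fderiv ℝ (radialExt ι) p) p :=
    (differentiableAt_radialExt hι (coe_ne_zero p)).hasFDerivAt
  have hdet : (sheetMap ι p N).det ≠ 0 := fun h =>
    hN0 (inner_self_eq_zero.1 ((det_sheetMap_eq_zero_iff hι p N).1 h))
  -- The added term is constant on the unit sphere, so increments there are those of `ι`, while
  -- radially it supplies the missing normal direction and makes the derivative invertible.
  have hK : HasFDerivAt (fun x : E3 => radialExt ι x + (2⁻¹ * ‖x‖ ^ 2) • N) (sheetMap ι p N) p := by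
    refine (hJ.add (((hasStrictFDerivAt_norm_sq (p : E3)).hasFDerivAt.const_mul
      (2⁻¹ : ℝ)).smul_const N)).congr_fderiv ?_
    ext ξ
    simp [sheetMap]
  have hΘ := hK.isTheta_sub
    ((sheetMap ι p N).toContinuousLinearEquivOfDetNeZero hdet).toHomeomorph.isInducing
  have ho : (fun x => inner ℝ (radialExt ι x - radialExt ι p) N) =o[𝓝 (p : E3)]
      fun x => x - (p : E3) := by
    have h1 := ((innerSL ℝ N).isBigO_comp (fun x => radialExt ι x - radialExt ι p -
      fderiv ℝ (radialExt ι) p (x - p)) (𝓝 (p : E3))).trans_isLittleO hJ.isLittleO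
    refine h1.congr_left fun x => ?_
    rw [innerSL_apply_apply, inner_sub_right, real_inner_comm _ N,
      real_inner_comm _ N, inner_fderiv_radialExt_orientedNormal hι, sub_zero]
  have h2 := (ho.trans_isBigO hΘ.isBigO_symm).bound hη
  have h3 := (continuous_subtype_val.tendsto p).eventually h2
  filter_upwards [h3] with p' hp'
  simpa [radialExt_coe, norm_coe] using hp'

/-- By compactness, the image of the complement of a neighbourhood of `p` is closed, and it misses
the simple point `ι p`. -/
theorem eventually_eq_imp_mem {ι : S2 → E3} (hι : Continuous ι) {p : S2}
    (huniq : ∀ p', ι p' = ι p → p' = p) {P : S2 → Prop} (hP : ∀ᶠ p' in 𝓝 p, P p') :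
    ∀ᶠ x in 𝓝 (ι p), ∀ p', ι p' = x → P p' := by
  obtain ⟨V, hV, hVo, hpV⟩ := _root_.eventually_nhds_iff.1 hP
  have hc : IsClosed (ι '' Vᶜ) := (hVo.isClosed_compl.isCompact.image hι).isClosed
  have hq : ι p ∉ ι '' Vᶜ := by
    rintro ⟨p', hp', he⟩
    exact hp' (huniq p' he ▸ hpV)
  filter_upwards [hc.isOpen_compl.mem_nhds hq] with x hx p' hp'
  by_contra hPp
  exact hx ⟨p', fun hm => hPp (hV p' hm), hp'⟩

/-- Near a simple point the immersed sphere is tangent to the plane orthogonal to the normal. -/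
theorem eventually_mem_range_inner_le {ι : S2 → E3} (hι : ContMDiff (𝓡 2) 𝓘(ℝ, E3) ∞ ι) {p : S2}
    (huniq : ∀ p', ι p' = ι p → p' = p) {η : ℝ} (hη : 0 < η) :
    ∀ᶠ x in 𝓝 (ι p), x ∈ range ι →
      |inner ℝ (x - ι p) (orientedNormal ι p)| ≤ η * ‖x - ι p‖ := by
  filter_upwards [eventually_eq_imp_mem hι.continuous huniq (eventually_inner_le hι p hη)]
    with x hx
  rintro ⟨p', rfl⟩
  exact hx p' rfl

/-- A transverse direction at a simple point has a convex conical neighbourhood that, locally and up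
to sign, avoids the immersed sphere. -/
theorem exists_cone {ι : S2 → E3} (hι : ContMDiff (𝓡 2) 𝓘(ℝ, E3) ∞ ι) {p : S2}
    (huniq : ∀ p', ι p' = ι p → p' = p) {v : E3} (hv : inner ℝ v (orientedNormal ι p) ≠ 0) :
    ∃ C : Set E3, IsOpen C ∧ Convex ℝ C ∧ v ∈ C ∧ (∀ w ∈ C, ∀ t : ℝ, 0 < t → t • w ∈ C) ∧
      (∀ w ∈ C, SignType.sign (inner ℝ w (orientedNormal ι p)) =
        SignType.sign (inner ℝ v (orientedNormal ι p))) ∧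
      ∃ ε > 0, ∀ w ∈ C, ‖w‖ < ε → ι p + w ∉ range ι ∧ ι p - w ∉ range ι := by
  set N := orientedNormal ι p with hN
  obtain ⟨σ, hσ, hσv⟩ : ∃ σ : ℝ, σ * SignType.sign (inner ℝ v N) = 1 ∧
      0 < σ * inner ℝ v N := by
    rcases lt_or_gt_of_ne hv with h | h
    · exact ⟨-1, by simp [h], by linarith⟩
    · exact ⟨1, by simp [h], by linarith⟩
  -- Here `σ` is the sign of `⟨v, N⟩`, and the cone is `η * ‖w‖ < σ * ⟨w, N⟩`. The denominator `‖v‖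
  -- + 1` makes the inequality strict at `v`; the sphere near `ι p` satisfies the opposite estimate.
  set η := σ * inner ℝ v N / (‖v‖ + 1) with hη
  have hηpos : 0 < η := by positivity
  have hσ1 : |σ| = 1 := by
    have h1 := congrArg abs hσ
    rw [abs_mul, abs_one] at h1
    rcases lt_or_gt_of_ne hv with h | h <;> simpa [h] using h1
  have hsgn : ∀ x : ℝ, 0 < σ * x → SignType.sign x = SignType.sign (inner ℝ v N) := fun x hx => by
    have h1 := sign_pos hx
    have h2 := sign_pos hσv
    rw [sign_mul] at h1 h2
    have h3 : SignType.sign σ ≠ 0 := by rw [sign_ne_zero]; rintro rfl; simp at hx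
    exact mul_left_cancel₀ h3 (h1.trans h2.symm)
  obtain ⟨ε, hε, hball⟩ := Metric.eventually_nhds_iff_ball.1
    (eventually_mem_range_inner_le hι huniq hηpos)
  refine ⟨{w | η * ‖w‖ < σ * inner ℝ w N}, ?_, ?_, ?_, ?_, ?_, ε, hε, ?_⟩
  · exact isOpen_lt (by fun_prop) (by fun_prop)
  · intro x hx y hy a b ha hb hab
    simp only [mem_ofPred_eq] at hx hy ⊢
    have h1 : ‖a • x + b • y‖ ≤ a * ‖x‖ + b * ‖y‖ := by
      refine (norm_add_le _ _).trans ?_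
      rw [norm_smul, norm_smul, Real.norm_of_nonneg ha, Real.norm_of_nonneg hb]
    rw [inner_add_left, real_inner_smul_left, real_inner_smul_left]
    have h2 := mul_le_mul_of_nonneg_left h1 hηpos.le
    rcases ha.eq_or_lt with rfl | ha'
    · have : b = 1 := by linarith
      subst this
      linarith
    · have h3 := mul_lt_mul_of_pos_left hx ha'
      have h4 := mul_le_mul_of_nonneg_left hy.le hb
      nlinarith
  · simp only [mem_ofPred_eq, hη]
    rw [div_mul_eq_mul_div, div_lt_iff₀ (by positivity)]
    nlinarith [norm_nonneg v]
  · intro w hw t ht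
    simp only [mem_ofPred_eq] at hw ⊢
    rw [norm_smul, Real.norm_of_nonneg ht.le, real_inner_smul_left]
    nlinarith
  · intro w hw
    exact hsgn _ (lt_of_le_of_lt (by positivity) hw)
  · intro w hw hwε
    have habs : |inner ℝ w N| > η * ‖w‖ := by
      have h1 : η * ‖w‖ < σ * inner ℝ w N := hw
      have h2 := le_abs_self (σ * inner ℝ w N)
      rw [abs_mul, hσ1, one_mul] at h2
      linarith
    constructor
    · intro hm
      have h := hball (ι p + w) (by simpa [mem_ball_iff_norm] using hwε) hm
      rw [add_sub_cancel_left] at h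
      linarith
    · intro hm
      have h := hball (ι p - w) (by simpa [mem_ball_iff_norm] using hwε) hm
      rw [sub_sub_cancel_left, inner_neg_left, abs_neg, norm_neg] at h
      linarith

/-! ### The cone over the immersed sphere -/

/-- Vanishing up to `2⁻¹` makes the cone smooth at the origin, where the radial extension is not.
The positive derivative beyond `2⁻¹` makes the cone move strictly outward along each ray. -/
theorem exists_profile : ∃ α : ℝ → ℝ, ContDiff ℝ ∞ α ∧ (∀ r ≤ 2⁻¹, α r = 0) ∧ α 1 = 1 ∧
    (∀ r, 2⁻¹ < r → 0 < α r ∧ ∃ α' > 0, HasDerivAt α α' r) ∧ StrictMonoOn α (Ici 2⁻¹) := by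
  set c := expNegInvGlue 2⁻¹ with hc
  have hc0 : 0 < c := expNegInvGlue.pos_of_pos (by norm_num)
  have hcd : ContDiff ℝ ∞ fun r : ℝ => expNegInvGlue (r - 2⁻¹) / c :=
    (expNegInvGlue.contDiff.comp (contDiff_id.sub contDiff_const)).div_const c
  have hder : ∀ r : ℝ, 2⁻¹ < r →
      ∃ α' > 0, HasDerivAt (fun r : ℝ => expNegInvGlue (r - 2⁻¹) / c) α' r := fun r hr => by
    have hr' : 0 < r - 2⁻¹ := by linarith
    have h1 : HasDerivAt (fun r : ℝ => Real.exp (-(r - 2⁻¹)⁻¹) / c)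
        (Real.exp (-(r - 2⁻¹)⁻¹) * (1 / (r - 2⁻¹) ^ 2) / c) r := by
      have := ((((hasDerivAt_id r).sub_const 2⁻¹).inv hr'.ne').neg.exp).div_const c
      refine this.congr_deriv ?_
      simp
      ring
    refine ⟨_, by positivity, h1.congr_of_eventuallyEq ?_⟩
    filter_upwards [lt_mem_nhds hr] with s hs
    rw [expNegInvGlue, if_neg (by linarith)]
  refine ⟨fun r => expNegInvGlue (r - 2⁻¹) / c, hcd, fun r hr => ?_, ?_,
    fun r hr => ⟨?_, hder r hr⟩, ?_⟩
  · beta_reduce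
    rw [expNegInvGlue.zero_of_nonpos (by linarith), zero_div]
  · norm_num at hc ⊢
    rw [← hc, div_self hc0.ne']
  · exact div_pos (expNegInvGlue.pos_of_pos (by linarith)) hc0
  · refine strictMonoOn_of_deriv_pos (convex_Ici _) hcd.continuous.continuousOn fun r hr => ?_
    rw [interior_Ici] at hr
    obtain ⟨α', hα', h⟩ := hder r hr
    rwa [h.deriv]

/-- The cone over the sphere with apex `a` and radial profile `α`. -/
noncomputable def coneMap (ι : S2 → E3) (α : ℝ → ℝ) (a : E3) (x : E3) : E3 :=
  α ‖x‖ • radialExt ι x + (1 - α ‖x‖) • a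

theorem coneMap_smul (ι : S2 → E3) (α : ℝ → ℝ) (a : E3) {r : ℝ} (hr : 0 < r) (p : S2) :
    coneMap ι α a (r • (p : E3)) = α r • ι p + (1 - α r) • a := by
  rw [coneMap, radialExt_smul ι hr, norm_smul, norm_coe, mul_one, Real.norm_of_nonneg hr.le]

theorem contDiff_coneMap {ι : S2 → E3} (hι : ContMDiff (𝓡 2) 𝓘(ℝ, E3) ∞ ι) {α : ℝ → ℝ}
    (hα : ContDiff ℝ ∞ α) (hα0 : ∀ r ≤ 2⁻¹, α r = 0) (a : E3) :
    ContDiff ℝ ∞ (coneMap ι α a) := by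
  rw [contDiff_iff_contDiffAt]
  intro x
  by_cases hx : x = 0
  · refine (contDiffAt_const (c := a)).congr_of_eventuallyEq ?_
    filter_upwards [ball_mem_nhds x (show (0 : ℝ) < 2⁻¹ by norm_num)] with y hy
    rw [hx, mem_ball_zero_iff] at hy
    rw [coneMap, hα0 _ hy.le]; simp
  · have h1 : ContDiffAt ℝ ∞ (fun x : E3 => α ‖x‖) x :=
      hα.contDiffAt.comp x (contDiffAt_norm ℝ hx)
    exact (h1.smul (contDiffAt_radialExt hι hx)).add
      ((contDiffAt_const.sub h1).smul contDiffAt_const)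

theorem frontier_unitBall : frontier (ball (0 : E3) 1) = sphere 0 1 := frontier_ball 0 one_ne_zero

theorem image_frontier_unitBall {ι : S2 → E3} {f : E3 → E3} (hfι : ∀ p : S2, f p = ι p) :
    f '' frontier (ball (0 : E3) 1) = range ι := by
  rw [frontier_unitBall]
  ext x
  constructor
  · rintro ⟨y, hy, rfl⟩; exact ⟨⟨y, hy⟩, (hfι ⟨y, hy⟩).symm⟩
  · rintro ⟨p, rfl⟩; exact ⟨p, p.2, hfι p⟩

section

variable {ι : S2 → E3} {α : ℝ → ℝ} {a w : E3} {μ : ℝ}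

/-- With `r = ‖x‖`, the equation reads `α r • (ι p - a) = μ • w`, that is `lam = μ / α r`. Inside
the ball `α r < 1`, hence `lam > μ`; conversely strict monotonicity gives one radius for each such
`lam`. -/
theorem bijOn_preimage_coneMap (hα : ContDiff ℝ ∞ α) (hα0 : ∀ r ≤ 2⁻¹, α r = 0) (hα1 : α 1 = 1)
    (hαpos : ∀ r, 2⁻¹ < r → 0 < α r) (hmono : StrictMonoOn α (Ici 2⁻¹)) (hw : w ≠ 0) (hμ : 0 < μ) :
    BijOn toSphere {x | x ∈ ball (0 : E3) 1 ∧ coneMap ι α a x = a + μ • w}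
      {p | ∃ lam, μ < lam ∧ ι p = a + lam • w} := by
  have hμw : μ • w ≠ 0 := smul_ne_zero hμ.ne' hw
  have key : ∀ x, coneMap ι α a x = a + μ • w →
      2⁻¹ < ‖x‖ ∧ α ‖x‖ • (ι (toSphere x) - a) = μ • w := fun x hx => by
    have h2 : α ‖x‖ • (ι (toSphere x) - a) = μ • w := by
      rw [← add_right_inj a, ← hx, coneMap, radialExt]
      module
    refine ⟨?_, h2⟩
    by_contra! h
    rw [hα0 _ h, zero_smul] at h2
    exact hμw h2.symm
  refine ⟨fun x hx => ?_, fun x hx y hy hxy => ?_, fun p hp => ?_⟩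
  · obtain ⟨h1, h2⟩ := key x hx.2
    have hpos := hαpos _ h1
    have hlt : α ‖x‖ < 1 := by
      rw [← hα1]
      exact hmono h1.le (by norm_num : (1 : ℝ) ∈ Ici 2⁻¹) (mem_ball_zero_iff.1 hx.1)
    refine ⟨μ / α ‖x‖, ?_, ?_⟩
    · rw [lt_div_iff₀ hpos]; nlinarith
    · rw [← sub_eq_iff_eq_add', div_eq_inv_mul, mul_smul, ← h2, smul_smul,
        inv_mul_cancel₀ hpos.ne', one_smul]
  · obtain ⟨h1, h2⟩ := key x hx.2
    obtain ⟨h3, h4⟩ := key y hy.2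
    have hne : ι (toSphere y) - a ≠ 0 := fun h => by
      rw [h, smul_zero] at h4; exact hμw h4.symm
    rw [hxy, ← h4] at h2
    have h5 : ‖x‖ = ‖y‖ := hmono.injOn h1.le h3.le (smul_left_injective ℝ hne h2)
    have hx0 : x ≠ 0 := by rintro rfl; rw [norm_zero] at h1; norm_num at h1
    have hy0 : y ≠ 0 := by rintro rfl; rw [norm_zero] at h3; norm_num at h3
    rw [← norm_smul_toSphere hx0, ← norm_smul_toSphere hy0, hxy, h5]
  · obtain ⟨lam, hlam, hp⟩ := hp
    have hl0 : 0 < lam := hμ.trans hlam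
    have hc : μ / lam ∈ Ioo (α 2⁻¹) (α 1) := by
      rw [hα0 _ le_rfl, hα1]
      exact ⟨div_pos hμ hl0, (div_lt_one hl0).2 hlam⟩
    obtain ⟨r, hr, hrα⟩ := intermediate_value_Ioo (by norm_num : (2⁻¹ : ℝ) ≤ 1)
      hα.continuous.continuousOn hc
    have hr0 : 0 < r := lt_trans (by norm_num) hr.1
    refine ⟨r • (p : E3), ⟨?_, ?_⟩, toSphere_smul hr0 p⟩
    · rw [mem_ball_zero_iff, norm_smul, norm_coe, mul_one, Real.norm_of_nonneg hr0.le]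
      exact hr.2
    · rw [coneMap_smul ι α a hr0, hrα, hp, smul_add, smul_smul, div_mul_cancel₀ _ hl0.ne']
      module

/-- The radial velocity of the cone is `α' • (ι p - a)`, a positive multiple of `w`. -/
theorem sign_det_coneMap (hι : ContMDiff (𝓡 2) 𝓘(ℝ, E3) ∞ ι)
    (hα0 : ∀ r ≤ 2⁻¹, α r = 0) (hαpos : ∀ r, 2⁻¹ < r → 0 < α r ∧ ∃ α' > 0, HasDerivAt α α' r)
    (hw : w ≠ 0) (hμ : 0 < μ) {x : E3} (hx : coneMap ι α a x = a + μ • w) :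
    SignType.sign (fderiv ℝ (coneMap ι α a) x).det =
      SignType.sign (inner ℝ w (orientedNormal ι (toSphere x))) := by
  have h2 : α ‖x‖ • (ι (toSphere x) - a) = μ • w := by
    rw [← add_right_inj a, ← hx, coneMap, radialExt]
    module
  have h1 : 2⁻¹ < ‖x‖ := by
    by_contra! h
    rw [hα0 _ h, zero_smul] at h2
    exact smul_ne_zero hμ.ne' hw h2.symm
  obtain ⟨hpos, α', hα', hder⟩ := hαpos _ h1
  have hx0 : x ≠ 0 := by rintro rfl; rw [norm_zero] at h1; norm_num at h1
  have h := sign_det_fderiv_radial hι (toSphere x) (norm_pos_iff.2 hx0) hder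
    ((hder.const_sub 1).smul_const a) hpos
  rw [norm_smul_toSphere hx0] at h
  have h3 : α' • ι (toSphere x) + -α' • a = (α' * (μ / α ‖x‖)) • w := by
    have : ι (toSphere x) - a = (μ / α ‖x‖) • w := by
      rw [div_eq_inv_mul, mul_smul, ← h2, smul_smul, inv_mul_cancel₀ hpos.ne', one_smul]
    rw [mul_smul, ← this]; module
  rw [h3, real_inner_smul_left, sign_mul, sign_pos (mul_pos hα' (div_pos hμ hpos)), one_mul] at h
  exact h

end

/-- The degree of a filling of the immersed sphere, computed by counting the sheets met by a ray. -/
theorem hasBrouwerDegree_of_ray {ι : S2 → E3} (hι : ContMDiff (𝓡 2) 𝓘(ℝ, E3) ∞ ι) {f : E3 → E3}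
    (hf : ContinuousOn f (closure (ball 0 1))) (hf' : ContDiffOn ℝ 1 f (ball 0 1))
    (hfι : ∀ p : S2, f p = ι p) {a w : E3} {μ : ℝ} (hw : w ≠ 0) (hμ : 0 < μ)
    (hmem : a + μ • w ∉ range ι)
    (htr : ∀ p : S2, ∀ lam, μ < lam → ι p = a + lam • w → inner ℝ w (orientedNormal ι p) ≠ 0) :
    {p | ∃ lam, μ < lam ∧ ι p = a + lam • w}.Finite ∧
    HasBrouwerDegree f (ball 0 1) (a + μ • w)
      (∑ᶠ p ∈ {p | ∃ lam, μ < lam ∧ ι p = a + lam • w},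
        (SignType.sign (inner ℝ w (orientedNormal ι p)) : ℤ)) := by
  obtain ⟨α, hα, hα0, hα1, hαpos, hmono⟩ := exists_profile
  have hbij := bijOn_preimage_coneMap (ι := ι) (a := a) hα hα0 hα1 (fun r hr => (hαpos r hr).1)
    hmono hw hμ
  set g := coneMap ι α a with hg
  have hgd : ContDiff ℝ 1 g := (contDiff_coneMap hι hα hα0 a).of_le (by simp)
  have hgι : ∀ p : S2, g p = ι p := fun p => by
    have := coneMap_smul ι α a one_pos p
    rw [one_smul, hα1] at this
    simpa [hg] using this
  have hb : Bornology.IsBounded (ball (0 : E3) 1) := isBounded_ball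
  have hreg : IsRegularValueOn g (ball 0 1) (a + μ • w) := by
    refine ⟨by rwa [image_frontier_unitBall hgι], fun x hx hgx => ?_⟩
    obtain ⟨lam, hlam, hp⟩ := hbij.mapsTo ⟨hx, hgx⟩
    rw [← sign_ne_zero, sign_det_coneMap hι hα0 hαpos hw hμ hgx, sign_ne_zero]
    exact htr _ lam hlam hp
  have hfin := finite_preimage isOpen_ball hb hgd.continuous.continuousOn hgd.contDiffOn hreg
  refine ⟨hbij.image_eq ▸ hfin.image _, ?_⟩
  obtain ⟨n, hn⟩ := exists_hasBrouwerDegree isOpen_ball hb hgd.continuous.continuousOn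
    hgd.contDiffOn hreg.1
  have hn' := hn.self_of_nhds
  have hcount := hn'.eq_signedPreimageCount hreg
  have heq : EqOn g f (frontier (ball 0 1)) := fun x hx => by
    rw [frontier_unitBall] at hx
    rw [hgι ⟨x, hx⟩, hfι ⟨x, hx⟩]
  have hfn := hasBrouwerDegree_congr_frontier isOpen_ball hb hgd.continuous.continuousOn
    hgd.contDiffOn hf hf' heq hn'
  rw [hcount] at hfn
  convert hfn using 1
  symm
  exact finsum_mem_eq_of_bijOn _ hbij fun x hx => by
    rw [sign_det_coneMap hι hα0 hαpos hw hμ hx.2]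

/-- The degree drops by the crossing sign along a path through a simple point. -/
theorem degree_jump {ι : S2 → E3} (hι : ContMDiff (𝓡 2) 𝓘(ℝ, E3) ∞ ι) {f : E3 → E3}
    (hf : ContinuousOn f (closure (ball 0 1))) (hf' : ContDiffOn ℝ 1 f (ball 0 1))
    (hfι : ∀ p : S2, f p = ι p) {π : ℝ → E3} {v : E3} {t : ℝ} {p : S2} (hπ : HasDerivAt π v t)
    (hp : π t = ι p) (huniq : ∀ p', ι p' = ι p → p' = p)
    (hv : inner ℝ v (orientedNormal ι p) ≠ 0) :
    ∃ n : ℤ, (∀ᶠ s in 𝓝[<] t, HasBrouwerDegree f (ball 0 1) (π s)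
        (SignType.sign (inner ℝ v (orientedNormal ι p)) + n)) ∧
      ∀ᶠ s in 𝓝[>] t, HasBrouwerDegree f (ball 0 1) (π s) n := by
  obtain ⟨C, hCo, hCc, hvC, hCs, hCsign, ε, hε, hCε⟩ := exists_cone hι huniq hv
  -- A direction `w` that is not a critical value of this map has no tangency on its ray: if `ι p' =
  -- ι p + lam • w` with `lam > 0` and `w` tangent to the sheet at `p'`, then `lam⁻¹ • p'` is a
  -- critical point with value `w`.
  have hd : ∀ x ∈ ({0}ᶜ : Set E3), DifferentiableAt ℝ
      (fun x : E3 => ‖x‖ • radialExt ι x + -‖x‖ • ι p) x := fun x hx => by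
    have h1 : DifferentiableAt ℝ (fun x : E3 => ‖x‖) x := (hasFDerivAt_norm hx).differentiableAt
    exact (h1.smul (differentiableAt_radialExt hι hx)).add (h1.neg.smul_const _)
  obtain ⟨w, hwC, hwreg⟩ := exists_mem_of_null volume (volume_criticalValues_eq_zero volume hd)
    hCo ⟨v, hvC⟩
  have hws : inner ℝ w (orientedNormal ι p) ≠ 0 := by
    rw [← sign_ne_zero, hCsign w hwC, sign_ne_zero]; exact hv
  have hw : w ≠ 0 := by rintro rfl; simp at hws
  have htr : ∀ p' : S2, ∀ lam : ℝ, 0 < lam → ι p' = ι p + lam • w →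
      inner ℝ w (orientedNormal ι p') ≠ 0 := fun p' lam hlam he h0 => by
    have hl := inv_pos.2 hlam
    refine hwreg ⟨lam⁻¹ • (p' : E3), smul_ne_zero hl.ne' (coe_ne_zero p'), ?_, ?_⟩
    · rw [radialExt_smul ι hl, norm_smul, norm_coe, mul_one, Real.norm_of_nonneg hl.le, he,
        smul_add, smul_smul, inv_mul_cancel₀ hlam.ne']
      module
    · have h := sign_det_fderiv_radial hι p' hl (hasDerivAt_id lam⁻¹)
        ((hasDerivAt_id lam⁻¹).neg.smul_const (ι p)) hl
      rw [show (1 : ℝ) • ι p' + (-1 : ℝ) • ι p = lam • w by rw [he]; module,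
        real_inner_smul_left, h0, mul_zero, sign_zero, sign_eq_zero_iff] at h
      exact h
  -- points just before and just after the crossing, on the ray from `ι p - w`
  obtain ⟨s, hs0, hs1, hsε⟩ : ∃ s : ℝ, 0 < s ∧ s < 1 ∧ s * ‖w‖ < ε := by
    have hw' : 0 < ‖w‖ := norm_pos_iff.2 hw
    refine ⟨min 2⁻¹ (ε / (2 * ‖w‖)), by positivity, (min_le_left _ _).trans_lt (by norm_num), ?_⟩
    calc min 2⁻¹ (ε / (2 * ‖w‖)) * ‖w‖ ≤ ε / (2 * ‖w‖) * ‖w‖ := by gcongr; exact min_le_right _ _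
      _ = ε / 2 := by field_simp
      _ < ε := half_lt_self hε
  set a := ι p - w with ha
  have hseg : ∀ u : ℝ, 0 < u → u ≤ s → u • w ∈ C ∧ ‖u • w‖ < ε := fun u hu hus => by
    refine ⟨hCs w hwC u hu, ?_⟩
    rw [norm_smul, Real.norm_of_nonneg hu.le]
    exact (mul_le_mul_of_nonneg_right hus (norm_nonneg w)).trans_lt hsε
  have hnot : ∀ u : ℝ, 0 < u → u ≤ s → ι p + u • w ∉ range ι ∧ ι p - u • w ∉ range ι :=
    fun u hu hus => hCε _ (hseg u hu hus).1 (hseg u hu hus).2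
  have haw : ∀ lam : ℝ, a + lam • w = ι p + (lam - 1) • w := fun lam => by rw [ha]; module
  have haw' : ∀ lam : ℝ, a + lam • w = ι p - (1 - lam) • w := fun lam => by rw [ha]; module
  have htrp : ∀ p' : S2, ∀ lam : ℝ, 1 - s < lam → ι p' = a + lam • w →
      (p' = p ∨ 1 + s < lam) ∧ inner ℝ w (orientedNormal ι p') ≠ 0 := fun p' lam hlam he => by
    rcases lt_trichotomy lam 1 with h | h | h
    · exact absurd ⟨p', he.trans (haw' lam)⟩ (hnot (1 - lam) (by linarith) (by linarith)).2
    · have : p' = p := huniq p' (by rw [he, haw, h, sub_self, zero_smul, add_zero])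
      exact ⟨.inl this, this ▸ hws⟩
    · refine ⟨?_, htr p' (lam - 1) (by linarith) (he.trans (haw lam))⟩
      by_contra! hc
      exact (hnot (lam - 1) (by linarith) (by linarith [hc.2])).1 ⟨p', he.trans (haw lam)⟩
  obtain ⟨-, hminus⟩ := hasBrouwerDegree_of_ray hι hf hf' hfι (a := a) (μ := 1 - s) hw
    (by linarith) (by rw [haw', sub_sub_cancel]; exact (hnot s hs0 le_rfl).2)
    (fun p' lam hlam he => (htrp p' lam hlam he).2)
  obtain ⟨hfin, hplus⟩ := hasBrouwerDegree_of_ray hι hf hf' hfι (a := a) (μ := 1 + s) hw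
    (by linarith) (by rw [haw, add_sub_cancel_left]; exact (hnot s hs0 le_rfl).1)
    (fun p' lam hlam he => (htrp p' lam (by linarith) he).2)
  -- Between parameters `1 - s` and `1 + s` the ray stays in the two-sided cone at `ι p`, so it
  -- meets the sphere only at parameter 1, on the sheet of `p`.
  have hset : {p' | ∃ lam, 1 - s < lam ∧ ι p' = a + lam • w} =
      insert p {p' | ∃ lam, 1 + s < lam ∧ ι p' = a + lam • w} := by
    ext p'
    simp only [mem_ofPred_eq, mem_insert_iff]
    constructor
    · rintro ⟨lam, hlam, he⟩
      exact (htrp p' lam hlam he).1.imp_right fun h => ⟨lam, h, he⟩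
    · rintro (rfl | ⟨lam, hlam, he⟩)
      · exact ⟨1, by linarith, by rw [haw, sub_self, zero_smul, add_zero]⟩
      · exact ⟨lam, by linarith, he⟩
  have hpnot : p ∉ {p' | ∃ lam, 1 + s < lam ∧ ι p' = a + lam • w} := by
    rintro ⟨lam, hlam, he⟩
    rw [haw, left_eq_add, smul_eq_zero] at he
    rcases he with he | he
    · linarith
    · exact hw he
  rw [hset, finsum_mem_insert _ hpnot hfin, hCsign w hwC] at hminus
  rw [haw', sub_sub_cancel] at hminus
  rw [haw, add_sub_cancel_left] at hplus
  refine ⟨∑ᶠ p' ∈ {p' | ∃ lam, 1 + s < lam ∧ ι p' = a + lam • w},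
      (SignType.sign (inner ℝ w (orientedNormal ι p')) : ℤ), ?_, ?_⟩
  -- The difference quotients of `π` tend to `v ∈ C`, so `ι p - π u` before the crossing and `π u -
  -- ι p` after it lie in the convex set `C ∩ ball 0 ε`. This set contains `s • w` as well, and the
  -- corresponding translate avoids the sphere, so the degree carries over from the ray to the path.
  all_goals
    have hCb : Convex ℝ (C ∩ ball 0 ε) := hCc.inter (convex_ball 0 ε)
    have hsw : s • w ∈ C ∩ ball 0 ε :=
      ⟨(hseg s hs0 le_rfl).1, mem_ball_zero_iff.2 (hseg s hs0 le_rfl).2⟩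
    have hcont := hπ.continuousAt
    have hsl := hasDerivAt_iff_tendsto_slope_left_right.1 hπ
  · have hA : IsPreconnected ((fun x => ι p - x) '' (C ∩ ball 0 ε)) :=
      hCb.isPreconnected.image _ (by fun_prop)
    have hclose : ∀ᶠ u in 𝓝[<] t, ‖ι p - π u‖ < ε := by
      have : ContinuousAt (fun u => ‖ι p - π u‖) t := (continuousAt_const.sub hcont).norm
      refine (this.tendsto.eventually (gt_mem_nhds ?_)).filter_mono nhdsWithin_le_nhds
      rw [hp, sub_self, norm_zero]; exact hε
    filter_upwards [hclose, hsl.1 (hCo.mem_nhds hvC), self_mem_nhdsWithin] with u hu1 hu2 hu3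
    have hu3' : 0 < t - u := sub_pos.2 hu3
    refine hasBrouwerDegree_of_isPreconnected isOpen_ball isBounded_ball hf hf' hA ?_
      ⟨s • w, hsw, rfl⟩ ⟨ι p - π u, ⟨?_, mem_ball_zero_iff.2 hu1⟩, sub_sub_cancel _ _⟩ hminus
    · rw [image_frontier_unitBall hfι]
      rintro _ ⟨x, hx, rfl⟩
      exact (hCε x hx.1 (mem_ball_zero_iff.1 hx.2)).2
    · have h := hCs _ hu2 _ hu3'
      rw [slope_comm, slope, vsub_eq_sub, smul_smul, mul_inv_cancel₀ hu3'.ne', one_smul, hp] at h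
      exact h
  · have hA : IsPreconnected ((fun x => ι p + x) '' (C ∩ ball 0 ε)) :=
      hCb.isPreconnected.image _ (by fun_prop)
    have hclose : ∀ᶠ u in 𝓝[>] t, ‖π u - ι p‖ < ε := by
      have : ContinuousAt (fun u => ‖π u - ι p‖) t := (hcont.sub continuousAt_const).norm
      refine (this.tendsto.eventually (gt_mem_nhds ?_)).filter_mono nhdsWithin_le_nhds
      rw [hp, sub_self, norm_zero]; exact hε
    filter_upwards [hclose, hsl.2 (hCo.mem_nhds hvC), self_mem_nhdsWithin] with u hu1 hu2 hu3
    have hu3' : 0 < u - t := sub_pos.2 hu3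
    refine hasBrouwerDegree_of_isPreconnected isOpen_ball isBounded_ball hf hf' hA ?_
      ⟨s • w, hsw, rfl⟩ ⟨π u - ι p, ⟨?_, mem_ball_zero_iff.2 hu1⟩, add_sub_cancel _ _⟩ hplus
    · rw [image_frontier_unitBall hfι]
      rintro _ ⟨x, hx, rfl⟩
      exact (hCε x hx.1 (mem_ball_zero_iff.1 hx.2)).1
    · have h := hCs _ hu2 _ hu3'
      rw [slope, vsub_eq_sub, smul_smul, mul_inv_cancel₀ hu3'.ne', one_smul, hp] at h
      exact h


/-! ### The index of a cable -/

/-- A function on `[0, 1]` that is locally constant off a finite set drops by the sum of its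
jumps. -/
theorem eq_add_sum_jumps (D j : ℝ → ℤ) (T : Finset ℝ) (h0 : (0 : ℝ) ∉ T) (h1 : (1 : ℝ) ∉ T)
    (hT : ∀ t ∈ T, t ∈ Icc (0 : ℝ) 1)
    (hD : ∀ t ∈ Icc (0 : ℝ) 1, t ∉ T → ∀ᶠ s in 𝓝[Icc 0 1] t, D s = D t)
    (hj : ∀ t ∈ T, ∃ m, (∀ᶠ s in 𝓝[<] t, D s = j t + m) ∧ ∀ᶠ s in 𝓝[>] t, D s = m) :
    D 0 = D 1 + ∑ t ∈ T, j t := by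
  classical
  choose! m hm1 hm2 using hj
  let S : ℝ → ℤ := fun s => ∑ t ∈ T, if t < s then j t else 0
  let E : ℝ → ℤ := fun s => (if s ∈ T then j s + m s else D s) + S s
  have hT' : ∀ s : ℝ, ∀ᶠ s' in 𝓝 s, ∀ t ∈ T, t ≠ s → (t < s' ↔ t < s) ∧ s' ≠ t := fun s => by
    rw [Filter.eventually_all_finset]
    intro t _
    rcases lt_trichotomy t s with h | h | h
    · filter_upwards [lt_mem_nhds h] with s' hs' _ using ⟨iff_of_true hs' h, hs'.ne'⟩
    · exact .of_forall fun s' hne => absurd h hne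
    · filter_upwards [gt_mem_nhds h] with s' hs' _ using
        ⟨iff_of_false hs'.not_gt h.not_gt, hs'.ne⟩
  have hE : ContinuousOn E (Icc 0 1) := fun s hs => by
    have hev : ∀ᶠ s' in 𝓝[Icc 0 1] s, E s' = E s := by
      by_cases hsT : s ∈ T
      · have hl : ∀ᶠ s' in 𝓝[<] s, E s' = E s := by
          filter_upwards [hm1 s hsT, (hT' s).filter_mono nhdsWithin_le_nhds, self_mem_nhdsWithin]
            with s' h1 h2 h3
          have h4 : s' ∉ T := fun h => (h2 s' h (ne_of_lt h3)).2 rfl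
          have h5 : S s' = S s := Finset.sum_congr rfl fun t ht => by
            by_cases hts : t = s
            · rw [hts, if_neg (lt_asymm h3), if_neg (lt_irrefl s)]
            · simp only [(h2 t ht hts).1]
          simp only [E, if_pos hsT, if_neg h4, h1, h5]
        have hr : ∀ᶠ s' in 𝓝[>] s, E s' = E s := by
          filter_upwards [hm2 s hsT, (hT' s).filter_mono nhdsWithin_le_nhds, self_mem_nhdsWithin]
            with s' h1 h2 h3
          have h4 : s' ∉ T := fun h => (h2 s' h (ne_of_gt h3)).2 rfl
          have h5 : S s' = S s + j s := by
            have h6 : j s = ∑ t ∈ T, if t = s then j t else 0 := by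
              rw [Finset.sum_ite_eq' T s, if_pos hsT]
            rw [h6, ← Finset.sum_add_distrib]
            refine Finset.sum_congr rfl fun t ht => ?_
            by_cases hts : t = s
            · rw [hts, if_pos (show s < s' from h3), if_neg (lt_irrefl s), if_pos rfl, zero_add]
            · simp only [(h2 t ht hts).1, if_neg hts, add_zero]
          simp only [E, if_pos hsT, if_neg h4, h1, h5]
          ring
        have hu : ∀ᶠ s' in 𝓝 s, E s' = E s := by
          rw [← nhdsNE_sup_pure, ← Iio_union_Ioi, nhdsWithin_union]
          simp only [eventually_sup]
          exact ⟨⟨hl, hr⟩, rfl⟩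
        exact hu.filter_mono nhdsWithin_le_nhds
      · filter_upwards [hD s hs hsT, (hT' s).filter_mono nhdsWithin_le_nhds] with s' h1 h2
        have h3 : ∀ t ∈ T, t ≠ s := fun t ht h => hsT (h ▸ ht)
        have h4 : s' ∉ T := fun h => (h2 s' h (h3 s' h)).2 rfl
        have h5 : S s' = S s := Finset.sum_congr rfl fun t ht => by
          simp only [(h2 t ht (h3 t ht)).1]
        simp only [E, if_neg hsT, if_neg h4, h1, h5]
    exact (continuousWithinAt_const (b := E s)).congr_of_eventuallyEq hev rfl
  have h := isPreconnected_Icc.constant hE (left_mem_Icc.2 zero_le_one)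
    (right_mem_Icc.2 zero_le_one)
  have hS0 : S 0 = 0 := Finset.sum_eq_zero fun t ht => if_neg (hT t ht).1.not_gt
  have hS1 : S 1 = ∑ t ∈ T, j t := Finset.sum_congr rfl fun t ht =>
    if_pos (lt_of_le_of_ne (hT t ht).2 fun he => h1 (he ▸ ht))
  simp only [E, if_neg h0, if_neg h1, hS0, hS1, add_zero] at h
  exact h

/-- The index of a cable is the difference of the degrees at its endpoints. -/
theorem cableIndex_eq_sub {ι : S2 → E3} (hι : ContMDiff (𝓡 2) 𝓘(ℝ, E3) ∞ ι) {f : E3 → E3}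
    (hf : ContinuousOn f (closure (ball 0 1))) (hf' : ContDiffOn ℝ 1 f (ball 0 1))
    (hfι : ∀ p : S2, f p = ι p) {y z : E3} {π : ℝ → E3} (hπ : IsCable ι y z π) {m n : ℤ}
    (hy : HasBrouwerDegree f (ball 0 1) y m) (hz : HasBrouwerDegree f (ball 0 1) z n) :
    cableIndex ι π = m - n := by
  classical
  have hfr := image_frontier_unitBall hfι
  have hy' : y ∉ range ι := hfr ▸ hy.1
  have hz' : z ∉ range ι := hfr ▸ hz.1
  set T := hπ.finite.toFinset with hT
  have hTm : ∀ {t}, t ∈ T ↔ t ∈ Icc (0 : ℝ) 1 ∧ π t ∈ range ι := fun {t} => by simp [hT]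
  have h0 : (0 : ℝ) ∉ T := fun h => hy' (hπ.source ▸ (hTm.1 h).2)
  have h1 : (1 : ℝ) ∉ T := fun h => hz' (hπ.target ▸ (hTm.1 h).2)
  have hp : ∀ t ∈ T, ∃ p, π t = ι p := fun t ht => by
    obtain ⟨p, hp⟩ := (hTm.1 ht).2
    exact ⟨p, hp.symm⟩
  have : Nonempty S2 := ⟨toSphere 0⟩
  choose! p hp using hp
  have hex : ∀ t ∈ Icc (0 : ℝ) 1, t ∉ T →
      ∃ k, ∀ᶠ x in 𝓝 (π t), HasBrouwerDegree f (ball 0 1) x k := fun t ht htT =>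
    exists_hasBrouwerDegree isOpen_ball isBounded_ball hf hf' (by
      rw [hfr]; exact fun h => htT (hTm.2 ⟨ht, h⟩))
  let D : ℝ → ℤ := fun t => if h : ∃ k, HasBrouwerDegree f (ball 0 1) (π t) k then h.choose else 0
  have hDeq : ∀ {t k}, HasBrouwerDegree f (ball 0 1) (π t) k → D t = k := fun {t k} h => by
    have hk : ∃ k, HasBrouwerDegree f (ball 0 1) (π t) k := ⟨k, h⟩
    simp only [D, dif_pos hk]
    exact hk.choose_spec.unique h
  have key := eq_add_sum_jumps D
    (fun t => (SignType.sign (inner ℝ (velocity π t) (orientedNormal ι (p t))) : ℤ)) T h0 h1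
    (fun t ht => (hTm.1 ht).1) (fun t ht htT => by
      obtain ⟨k, hk⟩ := hex t ht htT
      rw [hDeq hk.self_of_nhds]
      exact ((hπ.smooth.continuousOn t ht).eventually hk).mono fun s hs => hDeq hs)
    (fun t ht => by
      have htI := (hTm.1 ht).1
      -- The endpoints are off the surface, so crossing times are interior and the one-sided
      -- velocity is a genuine derivative.
      have htn : Icc (0 : ℝ) 1 ∈ 𝓝 t := Icc_mem_nhds
        (lt_of_le_of_ne htI.1 fun h => h0 (h ▸ ht)) (lt_of_le_of_ne htI.2 fun h => h1 (h ▸ ht))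
      have hd : HasDerivAt π (velocity π t) t :=
        ((hπ.smooth.differentiableOn (by simp)) t htI).hasDerivWithinAt.hasDerivAt htn
      obtain ⟨k, hk1, hk2⟩ := degree_jump hι hf hf' hfι hd (hp t ht)
        (fun p' he => hπ.regular t htI p' (p t) ((hp t ht).trans he.symm) (hp t ht))
        ((span_sup_range_eq_top_iff hι _ _).1 (hπ.transverse t htI _ (hp t ht)))
      exact ⟨k, hk1.mono fun s hs => hDeq hs, hk2.mono fun s hs => hDeq hs⟩)
  rw [hDeq (hπ.source ▸ hy), hDeq (hπ.target ▸ hz)] at key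
  have hset : {c : ℝ × S2 | c.1 ∈ Icc (0 : ℝ) 1 ∧ π c.1 = ι c.2} =
      (fun t => (t, p t)) '' (T : Set ℝ) := by
    ext ⟨t, p'⟩
    simp only [mem_ofPred_eq, mem_image, SetLike.mem_coe, Prod.mk.injEq]
    constructor
    · rintro ⟨ht, he⟩
      have htT : t ∈ T := hTm.2 ⟨ht, p', he.symm⟩
      exact ⟨t, htT, rfl, hπ.regular t ht _ _ (hp t htT) he⟩
    · rintro ⟨s, hs, rfl, rfl⟩
      exact ⟨(hTm.1 hs).1, hp s hs⟩
  have hindex : cableIndex ι π =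
      ∑ t ∈ T, (SignType.sign (inner ℝ (velocity π t) (orientedNormal ι (p t))) : ℤ) := by
    rw [cableIndex, hset, finsum_mem_image fun a _ b _ h => congrArg Prod.fst h,
      finsum_mem_coe_finset]
    refine Finset.sum_congr rfl fun t _ => ?_
    simp only [unitNormal, inner_smul_right]
    by_cases hN : orientedNormal ι (p t) = 0
    · simp [hN]
    · rw [sign_mul, sign_pos (inv_pos.2 (norm_pos_iff.2 hN)), one_mul]
  rw [hindex, key, add_sub_cancel_left]

/-- The degree vanishes on the exterior region. -/
theorem hasBrouwerDegree_exterior {ι : S2 → E3} {f : E3 → E3}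
    (hf : ContinuousOn f (closure (ball 0 1))) (hf' : ContDiffOn ℝ 1 f (ball 0 1))
    (hfι : ∀ p : S2, f p = ι p) {Ω : Set E3} (hΩ : IsExterior ι Ω) {z : E3} (hz : z ∈ Ω) :
    HasBrouwerDegree f (ball 0 1) z 0 := by
  obtain ⟨⟨x, -, rfl⟩, hunb⟩ := hΩ
  have hfr := image_frontier_unitBall hfι
  have hK : IsCompact (f '' closure (ball 0 1)) :=
    isBounded_ball.isCompact_closure.image_of_continuousOn hf
  -- An unbounded region leaves the compact image of the ball; a point outside it is a regular value
  -- with no preimages, hence of degree 0.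
  obtain ⟨w, hw, hwK⟩ : ∃ w ∈ connectedComponentIn (range ι)ᶜ x, w ∉ f '' closure (ball 0 1) := by
    by_contra! h
    exact hunb (hK.isBounded.subset h)
  have hreg : IsRegularValueOn f (ball 0 1) w :=
    ⟨fun h => hwK (image_mono frontier_subset_closure h),
      fun x hx he => absurd ⟨x, subset_closure hx, he⟩ hwK⟩
  obtain ⟨k, hk⟩ := exists_hasBrouwerDegree isOpen_ball isBounded_ball hf hf' hreg.1
  have hk' := hk.self_of_nhds
  have h0 : k = 0 := by
    rw [hk'.eq_signedPreimageCount hreg, signedPreimageCount]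
    have : {x | x ∈ ball (0 : E3) 1 ∧ f x = w} = ∅ :=
      eq_empty_of_forall_notMem fun x hx => hwK ⟨x, subset_closure hx.1, hx.2⟩
    rw [this, finsum_mem_empty]
  subst h0
  exact hasBrouwerDegree_of_isPreconnected isOpen_ball isBounded_ball hf hf'
    isPreconnected_connectedComponentIn (by rw [hfr]; exact connectedComponentIn_subset _ _) hw hz
    hk'


/-! ### Existence of cables -/

section
variable {E F G : Type*} [NormedAddCommGroup E] [NormedSpace ℝ E] [FiniteDimensional ℝ E]
  [NormedAddCommGroup F] [NormedSpace ℝ F] [FiniteDimensional ℝ F]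
  [NormedAddCommGroup G] [NormedSpace ℝ G]

/-- The image of a regular fibre under a strictly differentiable map locally has at most the
dimension of the fibre. -/
theorem exists_nhds_dimH_image_fiber_le {Φ : E → F} {Φ' : E →L[ℝ] F} {g : E → G} {g' : E →L[ℝ] G}
    {a : E} (hΦ : HasStrictFDerivAt Φ Φ' a) (hsurj : Φ'.range = ⊤) (hg : HasStrictFDerivAt g g' a) :
    ∃ U ∈ 𝓝 a, dimH (g '' (U ∩ {x | Φ x = Φ a})) ≤ (finrank ℝ E - finrank ℝ F : ℕ) := by
  have : CompleteSpace E := FiniteDimensional.complete ℝ E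
  have : CompleteSpace F := FiniteDimensional.complete ℝ F
  -- The implicit function parametrizes the fibre by the kernel of `Φ'`; composed with `g` it is
  -- locally Lipschitz, and such maps do not raise Hausdorff dimension.
  let φ := HasStrictFDerivAt.implicitFunctionDataOfComplemented Φ Φ' hΦ hsurj
    (Φ'.ker_closedComplemented_of_finiteDimensional_range)
  have h1 := φ.hasStrictFDerivAt_implicitFunction_fderiv
  have hpt : φ.implicitFunction (φ.leftFun φ.pt) (φ.rightFun φ.pt) = a :=
    φ.implicitFunction_apply_image.self_of_nhds
  have h2 : HasStrictFDerivAt g g' (φ.implicitFunction (φ.leftFun φ.pt) (φ.rightFun φ.pt)) := by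
    rwa [hpt]
  obtain ⟨K, W, hW, hlip⟩ := (h2.comp _ h1).exists_lipschitzOnWith
  have hcont : ContinuousAt φ.rightFun a := φ.hasStrictFDerivAt_rightFun.continuousAt
  refine ⟨{x | φ.implicitFunction (φ.leftFun x) (φ.rightFun x) = x} ∩ φ.rightFun ⁻¹' W,
    inter_mem φ.implicitFunction_apply_image (hcont hW), ?_⟩
  have hsub : g '' (({x | φ.implicitFunction (φ.leftFun x) (φ.rightFun x) = x} ∩
      φ.rightFun ⁻¹' W) ∩ {x | Φ x = Φ a}) ⊆
      (g ∘ φ.implicitFunction (φ.leftFun φ.pt)) '' W := by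
    rintro _ ⟨x, ⟨⟨hx1, hx2⟩, hx3⟩, rfl⟩
    refine ⟨φ.rightFun x, hx2, congrArg g ?_⟩
    have : φ.leftFun x = φ.leftFun φ.pt := hx3
    rw [← this]; exact hx1
  refine (dimH_mono hsub).trans (hlip.dimH_image_le.trans ((dimH_mono (subset_univ W)).trans ?_))
  rw [Real.dimH_univ_eq_finrank]
  have h3 := Φ'.toLinearMap.finrank_range_add_finrank_ker
  have h4 : finrank ℝ Φ'.range = finrank ℝ F := by rw [hsurj, finrank_top]
  have h5 : finrank ℝ Φ'.ker = finrank ℝ E - finrank ℝ F := by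
    rw [← h3, ← h4]; exact (Nat.add_sub_cancel_left _ _).symm
  exact_mod_cast h5.le

end

/-- A quadratic path from `y` to `z`, bent in the direction `w`. -/
noncomputable def cablePath (y z w : E3) (t : ℝ) : E3 :=
  y + t • (z - y) + (t * (1 - t)) • w

theorem hasDerivAt_cablePath (y z w : E3) (t : ℝ) :
    HasDerivAt (cablePath y z w) ((z - y) + (1 - 2 * t) • w) t := by
  have h1 : HasDerivAt (fun t : ℝ => t * (1 - t)) (1 - 2 * t) t :=
    ((hasDerivAt_id t).mul ((hasDerivAt_id t).const_sub 1)).congr_deriv (by simp; ring)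
  have h2 : HasDerivAt (fun t : ℝ => y + t • (z - y)) (z - y) t := by
    simpa using ((hasDerivAt_id t).smul_const (z - y)).const_add y
  exact h2.add (h1.smul_const w)

theorem contDiff_cablePath (y z w : E3) : ContDiff ℝ ∞ (cablePath y z w) := by
  unfold cablePath
  fun_prop

/-- The difference of two values is `(t - s) • ((z - y) + (1 - t - s) • w)`, and `|1 - t - s| ≤ 1`
on the unit interval. -/
theorem injOn_cablePath {y z w : E3} (hw : ‖w‖ < ‖z - y‖) : InjOn (cablePath y z w) (Icc 0 1) := by
  intro t ht s hs h
  by_contra hne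
  have h1 : (t - s) • ((z - y) + (1 - t - s) • w) = 0 := by
    rw [← sub_eq_zero.2 h]
    simp only [cablePath]
    module
  have h2 := (smul_eq_zero.1 h1).resolve_left (sub_ne_zero.2 hne)
  have h3 : ‖z - y‖ ≤ ‖w‖ := by
    rw [eq_neg_of_add_eq_zero_left h2, norm_neg, norm_smul]
    refine mul_le_of_le_one_left (norm_nonneg w) ?_
    rw [Real.norm_eq_abs, abs_le]
    constructor <;> linarith [ht.1, ht.2, hs.1, hs.2]
  exact hw.not_ge h3

/-- At an interior time exactly one `w` sends the path through `x`; bad parameters can thus be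
described as values of explicit maps. -/
theorem cablePath_eq_iff {y z w x : E3} {t : ℝ} (ht : t ∈ Ioo (0 : ℝ) 1) :
    cablePath y z w t = x ↔ (t * (1 - t))⁻¹ • (x - (y + t • (z - y))) = w := by
  have h : t * (1 - t) ≠ 0 := (mul_pos ht.1 (sub_pos.2 ht.2)).ne'
  rw [inv_smul_eq_iff₀ h, cablePath, sub_eq_iff_eq_add, add_comm, eq_comm]

/-- Almost every quadratic path from `y` to `z` is transverse to the sphere. -/
theorem measure_nontransverse_eq_zero {ι : S2 → E3} (hι : ContMDiff (𝓡 2) 𝓘(ℝ, E3) ∞ ι)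
    (μ : Measure E3) [μ.IsAddHaarMeasure] (y z : E3) :
    μ {w | ∃ t ∈ Ioo (0 : ℝ) 1, ∃ p, cablePath y z w t = ι p ∧
      inner ℝ ((z - y) + (1 - 2 * t) • w) (orientedNormal ι p) = 0} = 0 := by
  -- With these choices `α ‖x‖ • radialExt ι x + β ‖x‖` at `x = t • p` is the unique `w` whose path
  -- passes through `ι p` at time `t`.
  let α : ℝ → ℝ := fun r => (r * (1 - r))⁻¹
  let β : ℝ → E3 := fun r => -(α r • (y + r • (z - y)))
  have hα : ∀ r ∈ Ioo (0 : ℝ) 1, HasDerivAt α (-(1 - 2 * r) / (r * (1 - r)) ^ 2) r := fun r hr => by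
    have h1 : HasDerivAt (fun t : ℝ => t * (1 - t)) (1 - 2 * r) r :=
      ((hasDerivAt_id r).mul ((hasDerivAt_id r).const_sub 1)).congr_deriv (by simp; ring)
    exact h1.fun_inv (mul_pos hr.1 (sub_pos.2 hr.2)).ne'
  have hβ : ∀ r ∈ Ioo (0 : ℝ) 1, HasDerivAt β
      (-(α r • (z - y) + (-(1 - 2 * r) / (r * (1 - r)) ^ 2) • (y + r • (z - y)))) r :=
    fun r hr => by
      have h2 : HasDerivAt (fun t : ℝ => y + t • (z - y)) (z - y) r := by
        simpa using ((hasDerivAt_id r).smul_const (z - y)).const_add y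
      exact ((hα r hr).fun_smul h2).fun_neg
  have hdiff : ∀ x ∈ {x : E3 | ‖x‖ ∈ Ioo (0 : ℝ) 1},
      DifferentiableAt ℝ (fun x => α ‖x‖ • radialExt ι x + β ‖x‖) x := fun x hx => by
    have hx0 : x ≠ 0 := norm_pos_iff.1 hx.1
    have hn := (hasFDerivAt_norm hx0).differentiableAt
    have h1 : DifferentiableAt ℝ (fun x : E3 => α ‖x‖) x :=
      DifferentiableAt.comp (g := α) x (hα _ hx).differentiableAt hn
    have h2 : DifferentiableAt ℝ (fun x : E3 => β ‖x‖) x :=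
      DifferentiableAt.comp (g := β) x (hβ _ hx).differentiableAt hn
    exact (h1.fun_smul (differentiableAt_radialExt hι hx0)).fun_add h2
  refine measure_mono_null ?_ (volume_criticalValues_eq_zero μ hdiff)
  rintro w ⟨t, ht, p, hp, hin⟩
  have hpos : 0 < t * (1 - t) := mul_pos ht.1 (sub_pos.2 ht.2)
  have hnorm : ‖t • (p : E3)‖ = t := by
    rw [norm_smul, norm_coe, mul_one, Real.norm_of_nonneg ht.1.le]
  have hw := (cablePath_eq_iff ht).1 hp
  refine ⟨t • (p : E3), by simpa only [mem_ofPred_eq, hnorm] using ht, ?_, ?_⟩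
  · simp only [hnorm, radialExt_smul ι ht.1, β, α]
    rw [← hw]
    module
  · rw [← sign_eq_zero_iff, sign_det_fderiv_radial hι p ht.1 (hα t ht) (hβ t ht) (inv_pos.2 hpos),
      sign_eq_zero_iff]
    -- The radial derivative of that map is `-α t` times the velocity of the path, so a tangency is
    -- exactly a critical point.
    have : (-(1 - 2 * t) / (t * (1 - t)) ^ 2) • ι p +
        -(α t • (z - y) + (-(1 - 2 * t) / (t * (1 - t)) ^ 2) • (y + t • (z - y))) =
        (-α t) • ((z - y) + (1 - 2 * t) • w) := by
      have h3 : -(1 - 2 * t) / (t * (1 - t)) ^ 2 = -(1 - 2 * t) * α t * (t * (1 - t))⁻¹ := by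
        simp only [α]; field_simp
      rw [← hw, h3]
      module
    rw [this, inner_smul_left, hin, mul_zero]

/-- Almost every quadratic path from `y` to `z` avoids the multiple points of the sphere. -/
theorem measure_meets_multiple_points_eq_zero {ι : S2 → E3} (hι : IsTransverseImmersion ι)
    [MeasurableSpace E3] [BorelSpace E3] (y z : E3) :
    μH[finrank ℝ E3] {w | ∃ t ∈ Ioo (0 : ℝ) 1, ∃ p p', p ≠ p' ∧
      cablePath y z w t = ι p ∧ cablePath y z w t = ι p'} = 0 := by
  -- `A` consists of a time and a pair of distinct points with the same image. It lies in a fibre of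
  -- `Φ`, which has rank 5 in dimension 7 at these points, so the image under `g`, the bad `w`, has
  -- dimension at most 2.
  let A : Set (ℝ × E3 × E3) := {a | a.1 ∈ Ioo (0 : ℝ) 1 ∧ ‖a.2.1‖ = 1 ∧ ‖a.2.2‖ = 1 ∧
    a.2.1 ≠ a.2.2 ∧ radialExt ι a.2.1 = radialExt ι a.2.2}
  let Φ : ℝ × E3 × E3 → E3 × ℝ × ℝ := fun a =>
    (radialExt ι a.2.1 - radialExt ι a.2.2, ‖a.2.1‖ ^ 2, ‖a.2.2‖ ^ 2)
  let g : ℝ × E3 × E3 → E3 := fun a =>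
    (a.1 * (1 - a.1))⁻¹ • (radialExt ι a.2.1 - (y + a.1 • (z - y)))
  have hΦA : ∀ a ∈ A, Φ a = (0, 1, 1) := fun a ha => by
    simp only [Φ, ha.2.1, ha.2.2.1, ha.2.2.2.2, sub_self, one_pow]
  have hloc : ∀ a ∈ A, ∃ U ∈ 𝓝[A] a, dimH (g '' (U ∩ A)) ≤ 2 := fun ⟨t, x, x'⟩ ha => by
    obtain ⟨p, rfl⟩ : ∃ p : S2, (p : E3) = x := ⟨⟨x, mem_sphere_zero_iff_norm.2 ha.2.1⟩, rfl⟩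
    obtain ⟨p', rfl⟩ : ∃ p' : S2, (p' : E3) = x' :=
      ⟨⟨x', mem_sphere_zero_iff_norm.2 ha.2.2.1⟩, rfl⟩
    have hpp : p ≠ p' := fun h => ha.2.2.2.1 (congrArg Subtype.val h)
    have hιp : ι p = ι p' := by simpa only [radialExt_coe] using ha.2.2.2.2
    have ht : t * (1 - t) ≠ 0 := (mul_pos ha.1.1 (sub_pos.2 ha.1.2)).ne'
    have hJ := fun q : S2 => contDiffAt_radialExt hι.smooth (coe_ne_zero q)
    have hJ' := fun q : S2 => (hJ q).hasStrictFDerivAt (by simp)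
    have hfst : HasStrictFDerivAt (fun a : ℝ × E3 × E3 => a.2.1)
        ((ContinuousLinearMap.fst ℝ E3 E3).comp (ContinuousLinearMap.snd ℝ ℝ (E3 × E3)))
        (t, (p : E3), (p' : E3)) := hasStrictFDerivAt_fst.comp _ hasStrictFDerivAt_snd
    have hsnd : HasStrictFDerivAt (fun a : ℝ × E3 × E3 => a.2.2)
        ((ContinuousLinearMap.snd ℝ E3 E3).comp (ContinuousLinearMap.snd ℝ ℝ (E3 × E3)))
        (t, (p : E3), (p' : E3)) := hasStrictFDerivAt_snd.comp _ hasStrictFDerivAt_snd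
    have h1 := HasStrictFDerivAt.comp (t, (p : E3), (p' : E3)) (g := radialExt ι) (hJ' p) hfst
    have h2 := HasStrictFDerivAt.comp (t, (p : E3), (p' : E3)) (g := radialExt ι) (hJ' p') hsnd
    have h3 := HasStrictFDerivAt.comp (t, (p : E3), (p' : E3)) (g := fun x : E3 => ‖x‖ ^ 2)
      (hasStrictFDerivAt_norm_sq (p : E3)) hfst
    have h4 := HasStrictFDerivAt.comp (t, (p : E3), (p' : E3)) (g := fun x : E3 => ‖x‖ ^ 2)
      (hasStrictFDerivAt_norm_sq (p' : E3)) hsnd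
    have hΦ := (h1.sub h2).prodMk (h3.prodMk h4)
    have hg : ContDiffAt ℝ 1 g (t, (p : E3), (p' : E3)) := by
      have h5 : ContDiffAt ℝ 1 (fun a : ℝ × E3 × E3 => radialExt ι a.2.1)
          (t, (p : E3), (p' : E3)) :=
        ContDiffAt.comp (t, (p : E3), (p' : E3)) (g := radialExt ι) ((hJ p).of_le (by simp))
          (contDiff_fst.comp contDiff_snd).contDiffAt
      have h6 : ContDiffAt ℝ 1 (fun a : ℝ × E3 × E3 => a.1 * (1 - a.1))
          (t, (p : E3), (p' : E3)) := by fun_prop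
      have h7 : ContDiffAt ℝ 1 (fun a : ℝ × E3 × E3 => y + a.1 • (z - y))
          (t, (p : E3), (p' : E3)) := by fun_prop
      exact (h6.inv ht).smul (h5.sub h7)
    obtain ⟨U, hU, hdim⟩ := exists_nhds_dimH_image_fiber_le hΦ (by
      rw [LinearMap.range_eq_top]
      rintro ⟨η, b, b'⟩
      have hη : η ∈ (sphereDiff ι p).range ⊔ (sphereDiff ι p').range := by
        rw [hι.transverse p p' hpp hιp]; trivial
      rw [range_sphereDiff hι.smooth, range_sphereDiff hι.smooth] at hη
      obtain ⟨_, ⟨ζ, rfl⟩, _, ⟨ζ', rfl⟩, rfl⟩ := Submodule.mem_sup.1 hη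
      -- Transversality splits `η` into two tangent vectors. Radial components are invisible to the
      -- radial extension, so they can be adjusted to give the prescribed derivatives `b` and `b'`
      -- of the squared norms; the derivative `2 ⟨p, ·⟩` accounts for the halves.
      refine ⟨(0, ζ + (b / 2 - inner ℝ (p : E3) ζ) • (p : E3),
        -ζ' + (b' / 2 + inner ℝ (p' : E3) ζ') • (p' : E3)), ?_⟩
      refine Prod.ext ?_ (Prod.ext ?_ ?_)
      · simp [fderiv_radialExt_self hι.smooth]
      · simp [inner_add_right, inner_smul_right, mul_div_cancel₀]
      · simp [inner_add_right, inner_smul_right, mul_div_cancel₀])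
      (hg.hasStrictFDerivAt one_ne_zero)
    refine ⟨U, mem_nhdsWithin_of_mem_nhds hU, (dimH_mono (image_mono ?_)).trans (hdim.trans ?_)⟩
    · exact inter_subset_inter_right _ fun a' ha' => (hΦA a' ha').trans (hΦA _ ha).symm
    · simp
  choose! U hU hdim using hloc
  obtain ⟨T, hTA, hT, hcov⟩ := TopologicalSpace.countable_cover_nhdsWithin hU
  refine measure_mono_null (t := ⋃ a ∈ T, g '' (U a ∩ A)) ?_ ?_
  · rintro w ⟨t, ht, p, p', hpp, hp, hp'⟩
    have ha : (t, (p : E3), (p' : E3)) ∈ A := ⟨ht, norm_coe p, norm_coe p',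
      fun h => hpp (Subtype.ext h), by
        change radialExt ι p = radialExt ι p'
        rw [radialExt_coe, radialExt_coe, ← hp, hp']⟩
    obtain ⟨a, haT, haU⟩ := mem_iUnion₂.1 (hcov ha)
    refine mem_iUnion₂.2 ⟨a, haT, _, ⟨haU, ha⟩, ?_⟩
    simp only [g, radialExt_coe]
    exact (cablePath_eq_iff ht).1 hp
  · have h3 : finrank ℝ E3 = 3 := finrank_euclideanSpace_fin
    have : dimH (⋃ a ∈ T, g '' (U a ∩ A)) < ((3 : NNReal) : ENNReal) := by
      rw [dimH_bUnion hT]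
      refine (iSup₂_le fun a ha => hdim a (hTA ha)).trans_lt ?_
      norm_num
    simpa [h3] using hausdorffMeasure_of_dimH_lt this

/-- A path that meets the sphere transversely and only in simple points meets it finitely often. -/
theorem finite_crossings {ι : S2 → E3} (hι : ContMDiff (𝓡 2) 𝓘(ℝ, E3) ∞ ι) {π v : ℝ → E3}
    (hπ : ∀ t ∈ Icc (0 : ℝ) 1, HasDerivAt π (v t) t)
    (hreg : ∀ t ∈ Icc (0 : ℝ) 1, ∀ p p', π t = ι p → π t = ι p' → p = p')
    (htr : ∀ t ∈ Icc (0 : ℝ) 1, ∀ p, π t = ι p → inner ℝ (v t) (orientedNormal ι p) ≠ 0) :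
    {t ∈ Icc (0 : ℝ) 1 | π t ∈ range ι}.Finite := by
  -- The cone with apex 0 serves as an auxiliary filling. By `degree_jump` a degree exists just
  -- before and just after a crossing, which in particular puts those points off the surface;
  -- crossings are thus isolated in a compact set.
  obtain ⟨α, hα, hα0, hα1, -⟩ := exists_profile
  have hf := contDiff_coneMap hι hα hα0 0
  have hfι : ∀ p : S2, coneMap ι α 0 p = ι p := fun p => by
    simpa [hα1] using coneMap_smul ι α 0 one_pos p
  have hcl : IsCompact {t ∈ Icc (0 : ℝ) 1 | π t ∈ range ι} := by
    have hc : ContinuousOn π (Icc 0 1) := fun t ht => (hπ t ht).continuousAt.continuousWithinAt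
    exact isCompact_Icc.of_isClosed_subset (hc.preimage_isClosed_of_isClosed isClosed_Icc
      (isCompact_range hι.continuous).isClosed) inter_subset_left
  refine hcl.finite (isDiscrete_iff_forall_mem_exists_isOpen.2 fun t ht => ?_)
  obtain ⟨ht, p, hp⟩ := ht
  obtain ⟨n, hl, hr⟩ := degree_jump hι hf.continuous.continuousOn (hf.contDiffOn.of_le (by simp))
    hfι (hπ t ht) hp.symm (fun p' he => hreg t ht _ _ (hp.symm.trans he.symm) hp.symm)
    (htr t ht p hp.symm)
  have hev : ∀ᶠ s in 𝓝[≠] t, π s ∉ range ι := by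
    rw [← Iio_union_Ioi, nhdsWithin_union, eventually_sup, ← image_frontier_unitBall hfι]
    exact ⟨hl.mono fun s hs => hs.1, hr.mono fun s hs => hs.1⟩
  obtain ⟨V, hV, hVo, htV⟩ := _root_.eventually_nhds_iff.1 (eventually_nhdsWithin_iff.1 hev)
  refine ⟨V, hVo, ?_⟩
  ext s
  simp only [mem_inter_iff, mem_ofPred_eq, mem_singleton_iff]
  constructor
  · rintro ⟨h1, -, h3⟩
    by_contra hne
    exact hV s h1 hne h3
  · rintro rfl; exact ⟨htV, ht, p, hp⟩

theorem exists_isCable {ι : S2 → E3} (hι : IsTransverseImmersion ι) {y z : E3} (hy : y ∉ range ι)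
    (hz : z ∉ range ι) (hyz : y ≠ z) : ∃ π, IsCable ι y z π := by
  -- The three-dimensional Hausdorff measure is a Haar measure, so it handles both the critical
  -- values and the low-dimensional set. The radius `‖z - y‖` is what makes the path simple.
  obtain ⟨w, hw, hwN⟩ := exists_mem_of_null μH[finrank ℝ E3]
    (measure_union_null (measure_nontransverse_eq_zero hι.smooth _ y z)
      (measure_meets_multiple_points_eq_zero hι y z))
    (isOpen_ball (x := (0 : E3)) (ε := ‖z - y‖))
    (nonempty_ball.2 (norm_pos_iff.2 (sub_ne_zero.2 hyz.symm)))
  rw [mem_ball_zero_iff] at hw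
  have h0 : cablePath y z w 0 = y := by simp [cablePath]
  have h1 : cablePath y z w 1 = z := by simp [cablePath]
  have hIoo : ∀ t ∈ Icc (0 : ℝ) 1, ∀ p, cablePath y z w t = ι p → t ∈ Ioo (0 : ℝ) 1 :=
    fun t ht p hp => ⟨lt_of_le_of_ne ht.1 fun h => hy ⟨p, by rw [← hp, ← h, h0]⟩,
      lt_of_le_of_ne ht.2 fun h => hz ⟨p, by rw [← hp, h, h1]⟩⟩
  have hreg : ∀ t ∈ Icc (0 : ℝ) 1, ∀ p p', cablePath y z w t = ι p → cablePath y z w t = ι p' →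
      p = p' := fun t ht p p' hp hp' => by
    by_contra hne
    exact hwN (.inr ⟨t, hIoo t ht p hp, p, p', hne, hp, hp'⟩)
  have htr : ∀ t ∈ Icc (0 : ℝ) 1, ∀ p, cablePath y z w t = ι p →
      inner ℝ ((z - y) + (1 - 2 * t) • w) (orientedNormal ι p) ≠ 0 := fun t ht p hp hin =>
    hwN (.inl ⟨t, hIoo t ht p hp, p, hp, hin⟩)
  exact ⟨cablePath y z w,
    { smooth := (contDiff_cablePath y z w).contDiffOn
      simple := injOn_cablePath hw
      source := h0
      target := h1
      finite := finite_crossings hι.smooth (fun t _ => hasDerivAt_cablePath y z w t) hreg htr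
      regular := hreg
      transverse := fun t ht p hp => by
        rw [span_sup_range_eq_top_iff hι.smooth, velocity,
          (hasDerivAt_cablePath y z w t).hasDerivWithinAt.derivWithin
            (uniqueDiffOn_Icc zero_lt_one t ht)]
        exact htr t ht p hp }⟩

end CableIndex

/-! ### Degree and cable index of a region -/

theorem proposition3p1 (ι : S2 → E3) (hι : IsTransverseImmersion ι)
    (f : E3 → E3) (hf : ContDiffOn ℝ 1 f (closedBall 0 1)) (hfι : ∀ p : S2, f p = ι p)
    (Ω Ω_inf : Set E3) (hΩ : IsRegion ι Ω) (hΩ_inf : IsExterior ι Ω_inf) :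
    ∃ C : ℤ,
      (∀ y ∈ Ω, HasBrouwerDegree f (ball 0 1) y C) ∧
      (∀ y ∈ Ω, ∀ z ∈ Ω_inf, y ≠ z → ∃ π, IsCable ι y z π) ∧
      (∀ y ∈ Ω, ∀ z ∈ Ω_inf, ∀ π, IsCable ι y z π → cableIndex ι π = C) := by
  have hc : ContinuousOn f (closure (ball 0 1)) := by
    rw [closure_ball 0 one_ne_zero]; exact hf.continuousOn
  have hd : ContDiffOn ℝ 1 f (ball 0 1) := hf.mono ball_subset_closedBall
  have hfr := CableIndex.image_frontier_unitBall hfι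
  obtain ⟨x, hx, rfl⟩ := hΩ
  obtain ⟨C, hC⟩ := CableIndex.exists_hasBrouwerDegree isOpen_ball isBounded_ball hc hd
    (y := x) (by rw [hfr]; exact hx)
  have hdeg : ∀ y ∈ connectedComponentIn (range ι)ᶜ x, HasBrouwerDegree f (ball 0 1) y C :=
    fun y hy => CableIndex.hasBrouwerDegree_of_isPreconnected isOpen_ball isBounded_ball hc hd
      isPreconnected_connectedComponentIn (by rw [hfr]; exact connectedComponentIn_subset _ _)
      (mem_connectedComponentIn hx) hy hC.self_of_nhds
  refine ⟨C, hdeg, fun y hy z hz hyz => ?_, fun y hy z hz π hπ => ?_⟩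
  · have hz' := CableIndex.hasBrouwerDegree_exterior hc hd hfι hΩ_inf hz
    exact CableIndex.exists_isCable hι (connectedComponentIn_subset _ _ hy) (hfr ▸ hz'.1) hyz
  · rw [CableIndex.cableIndex_eq_sub hι.smooth hc hd hfι hπ (hdeg y hy)
      (CableIndex.hasBrouwerDegree_exterior hc hd hfι hΩ_inf hz), sub_zero]
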